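/- Let $V$ be a real vector space of finite dimension $n$, let $\Gamma\subset V$ be a lattice of rank $n$ and $\Gamma^*\subset V^*$ its dual lattice. Let $\Phi=[\beta_1,\dots,\beta_N]$ be a sequence of not necessarily distinct elements of $\Gamma^*$ that spans $V^*$ and is such that the only $x\in\mathbb R_{\ge 0}^N$ with $\sum_k x_k\beta_k=0$ is $x=0$. Notation: * For a set $s$ of indices, $C(s)$ is the closed convex cone generated by the $\beta_k$, $k\in s$, and $C(\Phi)=C(\{1,\dots,N\})$. A chamber is a connected component of the complement in $V^*$ of the union of the cones $C(s)$ with $|s|<n$. * $\Box(\Phi)=\sum_{k=1}^N[0,1]\beta_k$. * $\Pi_\Phi(\lambda)=\{x\in\mathbb R_{\ge0}^N : \sum_k x_k\beta_k=\lambda\}$. * For a chamber $\mathfrak c$, $\mathcal B(\Phi,\mathfrak c)$ is the set of the $n$-element sets $\sigma$ of indices such that $(\beta_j)_{j\in\sigma}$ is a basis of $V^*$ and $\mathfrak c\subset C(\sigma)$. * $\mathrm{vol}_{\Gamma^*}(\sigma)$ is the volume of the parallelepiped $\sum_{j\in\sigma}[0,1]\beta_j$ for the Haar measure on $V^*$ that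 gives volume $1$ to a minimal parallelepiped of $\Gamma^*$. * For $y\in\mathbb C^N$, $G(\sigma,y,\Gamma)=\{p\in V_{\mathbb C} : e^{\langle\beta_j,p\rangle}=e^{-y_j}\text{ for all }j\in\sigma\}$, where $V_{\mathbb C}=\mathbb C\otimes_{\mathbb R}V$, and $RG(\sigma,y,\Gamma)\subset G(\sigma,y,\Gamma)$ is any set of representatives of $G(\sigma,y,\Gamma)$ modulo $2\pi i\Gamma$. * $y$ is generic (for $\mathfrak c$) if $e^{y_k}e^{\langle\beta_k,p\rangle}\ne1$ for all $\sigma\in\mathcal B(\Phi,\mathfrak c)$, $p\in G(\sigma,y,\Gamma)$ and $k\notin\sigma$. **Theorem.** Let $\mathfrak c$ be a chamber. The generic $y$ form a dense open subset of $\mathbb C^N$. If $y$ is generic, then the sets $RG(\sigma,y,\Gamma)$, $\sigma\in\mathcal B(\Phi,\mathfrak c)$, are finite, and for every $\lambda\in(\mathfrak c-\Box(\Phi))\cap\Gamma^*$ the set $\Pi_\Phi(\lambda)\cap\mathbb Z^N$ is finite and $$\sum_{\xi\in\Pi_\Phi(\lambda)\cap\mathbb Z^N}e^{\langle y,\xi\rangle}=\sum_{\sigma\in\mathcal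 B(\Phi,\mathfrak c)}\frac1{\mathrm{vol}_{\Gamma^*}(\sigma)}\sum_{p\in RG(\sigma,y,\Gamma)}e^{-\langle\lambda,p\rangle}\prod_{k\notin\sigma}\frac1{1-e^{y_k}e^{\langle\beta_k,p\rangle}}.$$ If $\mathfrak c\subset C(\Phi)$, then $\overline{\mathfrak c}\subset\mathfrak c-\Box(\Phi)$, so that the formula holds in particular for every $\lambda\in\overline{\mathfrak c}\cap\Gamma^*$. -/

import Mathlib

open Set Module MeasureTheory
open scoped TensorProduct Pointwise

noncomputable section

namespace PartitionPolytope

section Lattice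

variable {V : Type*} [NormedAddCommGroup V] [NormedSpace ℝ V]

/-- The dual lattice `Γ*`: the linear forms on `V` that take integer values on `Γ`. -/
def dualLattice (Γ : Submodule ℤ V) : Submodule ℤ (StrongDual ℝ V) where
  carrier := {f | ∀ γ ∈ Γ, ∃ m : ℤ, f γ = m}
  zero_mem' := fun γ _ => ⟨0, by simp⟩
  add_mem' := by
    intro f g hf hg γ hγ
    obtain ⟨a, ha⟩ := hf γ hγ
    obtain ⟨b, hb⟩ := hg γ hγ
    exact ⟨a + b, by simp [ha, hb]⟩
  smul_mem' := by
    intro k f hf γ hγ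
    obtain ⟨a, ha⟩ := hf γ hγ
    exact ⟨k * a, by simp [ha]⟩

/-- The Haar measure on `V*` normalized so that a minimal parallelepiped of the dual lattice
has volume `1`: an arbitrary Haar measure divided by the covolume that it gives to `Γ*`. -/
def latticeVolume [FiniteDimensional ℝ V] (Γ : Submodule ℤ V) : Measure (StrongDual ℝ V) :=
  (ENNReal.ofReal (ZLattice.covolume (dualLattice Γ) Measure.addHaar))⁻¹ • Measure.addHaar

/-- The complexification of `V`. -/
abbrev Complexified (V : Type*) [NormedAddCommGroup V] [NormedSpace ℝ V] : Type _ := ℂ ⊗[ℝ] V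

/-- The complex-linear extension of a real linear form: `⟨f, z ⊗ v⟩ = z * f v`. -/
def pair (f : StrongDual ℝ V) : Complexified V →ₗ[ℂ] ℂ :=
  LinearMap.liftBaseChange ℂ (Complex.ofRealCLM.toLinearMap ∘ₗ f.toLinearMap)

/-- The subgroup `2πiΓ` of the complexification of `V`. -/
def twoPiILattice (Γ : Submodule ℤ V) : Set (Complexified V) :=
  {p | ∃ γ ∈ Γ, p = (2 * (Real.pi : ℂ) * Complex.I) ⊗ₜ[ℝ] γ}

end Lattice

section Configuration

variable {V : Type*} [NormedAddCommGroup V] [NormedSpace ℝ V] {N : ℕ}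

/-- The closed convex cone generated by the vectors `Φ i`, `i ∈ s`. -/
def cone (Φ : Fin N → StrongDual ℝ V) (s : Finset (Fin N)) : Set (StrongDual ℝ V) :=
  {a | ∃ t : Fin N → ℝ, (∀ i, 0 ≤ t i) ∧ a = ∑ i ∈ s, t i • Φ i}

/-- The singular vectors: those in a cone generated by fewer than `dim V` elements of `Φ`. -/
def singularSet (Φ : Fin N → StrongDual ℝ V) : Set (StrongDual ℝ V) :=
  {a | ∃ s : Finset (Fin N), s.card < finrank ℝ V ∧ a ∈ cone Φ s}

/-- A (big) chamber is a connected component of the set of regular (non-singular) vectors. -/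
def IsChamber (Φ : Fin N → StrongDual ℝ V) (c : Set (StrongDual ℝ V)) : Prop :=
  ∃ a ∈ (singularSet Φ)ᶜ, c = connectedComponentIn (singularSet Φ)ᶜ a

/-- The partition polytope `Π_Φ(a)`: the nonnegative real solutions of `∑ xₖ Φₖ = a`. -/
def partitionPolytope (Φ : Fin N → StrongDual ℝ V) (a : StrongDual ℝ V) : Set (Fin N → ℝ) :=
  {x | (∀ k, 0 ≤ x k) ∧ ∑ k, x k • Φ k = a}

/-- The points of `ℤ^N` lying in the partition polytope `Π_Φ(a)`. -/
def latticePoints (Φ : Fin N → StrongDual ℝ V) (a : StrongDual ℝ V) : Set (Fin N → ℤ) :=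
  {ξ | (fun k => (ξ k : ℝ)) ∈ partitionPolytope Φ a}

/-- The zonotope `∑ [0,1] Φₖ`. -/
def box (Φ : Fin N → StrongDual ℝ V) : Set (StrongDual ℝ V) :=
  parallelepiped Φ

/-- The subsequences `σ` of `Φ`, given by their sets of indices, that are bases of `V*`. -/
def IsBasis (Φ : Fin N → StrongDual ℝ V) (σ : Finset (Fin N)) : Prop :=
  σ.card = finrank ℝ V ∧ LinearIndependent ℝ (fun i : σ => Φ i)

open Classical in
/-- The set `B(Φ, c)` of the bases `σ` from `Φ` such that the chamber `c` is contained in the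
cone generated by `σ`. -/
def chamberBases (Φ : Fin N → StrongDual ℝ V) (c : Set (StrongDual ℝ V)) :
    Finset (Finset (Fin N)) :=
  Finset.univ.filter fun σ => IsBasis Φ σ ∧ c ⊆ cone Φ σ

/-- The set `G(σ, y, Γ)` of the points `p` of the complexification of `V` with
`exp ⟨Φⱼ, p⟩ = exp (-yⱼ)` for all `j ∈ σ`. -/
def polePoints (Φ : Fin N → StrongDual ℝ V) (y : Fin N → ℂ) (σ : Finset (Fin N)) :
    Set (Complexified V) :=
  {p | ∀ j ∈ σ, Complex.exp (pair (Φ j) p) = Complex.exp (-y j)}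

/-- `R` is a reduced set of elements of `G(σ, y, Γ)`: a subset that contains exactly one element
of each class modulo `2πiΓ`. -/
def IsReducedSet (Γ : Submodule ℤ V) (Φ : Fin N → StrongDual ℝ V) (y : Fin N → ℂ)
    (σ : Finset (Fin N)) (R : Set (Complexified V)) : Prop :=
  R ⊆ polePoints Φ y σ ∧
    ∀ p ∈ polePoints Φ y σ, ∃! q, q ∈ R ∧ p - q ∈ twoPiILattice Γ

/-- `y` is generic for `Φ` and the chamber `c`: no factor `1 - exp (yₖ) exp ⟨Φₖ, p⟩` with `k ∉ σ`
vanishes at a point `p` of `G(σ, y, Γ)`, for `σ ∈ B(Φ, c)`. -/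
def IsGeneric (Φ : Fin N → StrongDual ℝ V) (c : Set (StrongDual ℝ V)) (y : Fin N → ℂ) : Prop :=
  ∀ σ ∈ chamberBases Φ c, ∀ p ∈ polePoints Φ y σ, ∀ k ∉ σ,
    Complex.exp (y k) * Complex.exp (pair (Φ k) p) ≠ 1

/-- The volume, relative to `Γ*`, of the parallelepiped spanned by the `Φ i`, `i ∈ σ`. -/
def basisVolume [FiniteDimensional ℝ V] (Γ : Submodule ℤ V) (Φ : Fin N → StrongDual ℝ V)
    (σ : Finset (Fin N)) : ℝ :=
  (latticeVolume Γ).real (parallelepiped fun i : σ => Φ i)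

/-- The sum of the values of the exponential `exp ⟨y, ·⟩` at the integral points of `Π_Φ(a)`. -/
def expSum (Φ : Fin N → StrongDual ℝ V) (y : Fin N → ℂ) (a : StrongDual ℝ V) : ℂ :=
  ∑ᶠ ξ ∈ latticePoints Φ a, Complex.exp (∑ k, y k * (ξ k : ℂ))

/-- The explicit sum `E[c, y, Φ](a)` over the bases in `B(Φ, c)`; the set `R σ` is the chosen
reduced set of elements of `G(σ, y, Γ)`. -/
def explicitSum [FiniteDimensional ℝ V] (Γ : Submodule ℤ V) (Φ : Fin N → StrongDual ℝ V)
    (c : Set (StrongDual ℝ V)) (y : Fin N → ℂ) (R : Finset (Fin N) → Set (Complexified V))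
    (a : StrongDual ℝ V) : ℂ :=
  ∑ σ ∈ chamberBases Φ c, ((basisVolume Γ Φ σ : ℝ) : ℂ)⁻¹ *
    ∑ᶠ p ∈ R σ, Complex.exp (-pair a p) *
      ∏ k ∈ σᶜ, 1 / (1 - Complex.exp (y k) * Complex.exp (pair (Φ k) p))

end Configuration

end PartitionPolytope

end

/-! For a set `S` of indices let `subSum` and `subExplicit` be the two sides restricted to `S`:
points supported in `S`, respectively bases inside `S` and factors with index in `S`. By strong
induction on `S` they agree at lattice points of `c - subBox Φ S`; `S = univ` is the formula.

Both sides satisfy f_S(μ) - exp(y_k) f_S(μ - Φ_k) = f_{S \ k}(μ) for `k ∈ S` (`subSum_sub`,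
`subExplicit_sub`). By induction their difference D satisfies D(μ) = exp(y_k) D(μ - Φ_k) whenever μ
lies in `c - subBox Φ (S.erase k)`. A lattice path shadowing a ray in the open cone `c` stays in the
region where these recurrences hold, so D is quasi-periodic along it (`eq_exp_mul_of_path`) and may
be studied arbitrarily deep in `c`. There, two paths with the same endpoints give different
exponential factors as soon as some integral relation among the Φ_i is not respected by `y`, and D
vanishes (`eq_zero_of_recurrence`). Genericity supplies such a relation when `S` strictly contains a
basis of the chamber (`IsBasis.exists_relation`).

Two cases remain. If the cone of `S` misses `c`, both sides are zero. If `S` is itself a basis σ,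
the formula is orthogonality of characters on a finite group whose order is the volume of σ
(`IsBasis.exists_finsum_eq`, `IsBasis.basisVolume_eq`).

The inclusion for the closure is separate: a chamber inside C(Φ) contains every point interior to
all the simplicial cones of its bases (`IsChamber.mem_of_forall_coord_pos`). -/

namespace PartitionPolytope

/-! ### Carathéodory's theorem -/

/-- Carathéodory's theorem for cones, relative to a linearly independent family `T` whose
coefficients may have any sign. -/
theorem exists_linearIndepOn_union {ι E : Type*} [DecidableEq ι] [AddCommGroup E] [Module ℝ E]
    {Φ : ι → E} {T : Finset (ι)} (hT : LinearIndepOn ℝ Φ T)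
    {S : Finset (ι)} (hTS : Disjoint T S) {r u : ι → ℝ} (hu : ∀ i, 0 ≤ u i)
    {v : E} (hv : v = ∑ i ∈ T, r i • Φ i + ∑ i ∈ S, u i • Φ i) :
    ∃ U ⊆ S, LinearIndepOn ℝ Φ ((T ∪ U : Finset (ι)) : Set (ι)) ∧
      ∃ r' u' : ι → ℝ, (∀ i, 0 ≤ u' i) ∧
        v = ∑ i ∈ T, r' i • Φ i + ∑ i ∈ U, u' i • Φ i := by
  induction hn : S.card generalizing S r u with
  | zero =>
    rw [Finset.card_eq_zero] at hn
    subst hn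
    exact ⟨∅, subset_rfl, by simpa using hT, r, u, hu, hv⟩
  | succ n ih =>
    by_cases hli : LinearIndepOn ℝ Φ ((T ∪ S : Finset (ι)) : Set (ι))
    · exact ⟨S, subset_rfl, hli, r, u, hu, hv⟩
    -- Independence of `T` forces a nonzero coefficient in `S`; changing the sign of the relation
    -- makes it positive.
    obtain ⟨g, hg0, hgpos⟩ : ∃ g : ι → ℝ, ∑ i ∈ T, g i • Φ i + ∑ i ∈ S, g i • Φ i = 0 ∧
        ∃ i ∈ S, 0 < g i := by
      rw [linearIndepOn_finset_iff] at hli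
      push Not at hli
      obtain ⟨g, hg, i, hi, hgi⟩ := hli
      rw [Finset.sum_union hTS] at hg
      obtain ⟨j, hj, hgj⟩ : ∃ j ∈ S, g j ≠ 0 := by
        by_contra! hcon
        rw [Finset.sum_eq_zero (s := S) fun j hj => by rw [hcon j hj, zero_smul], add_zero] at hg
        rcases Finset.mem_union.1 hi with hi | hi
        · exact hgi (linearIndepOn_finset_iff.1 hT g hg i hi)
        · exact hgi (hcon i hi)
      rcases hgj.lt_or_gt with h | h
      · refine ⟨fun i => -g i, ?_, j, hj, by simpa using h⟩
        simp only [neg_smul, Finset.sum_neg_distrib]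
        rw [← neg_add, hg, neg_zero]
      · exact ⟨g, hg, j, hj, h⟩
    obtain ⟨i₀, hi₀, hmin⟩ := Finset.exists_min_image (S.filter fun i => 0 < g i)
      (fun i => u i / g i) (by
        obtain ⟨i, hi, hgi⟩ := hgpos
        exact ⟨i, Finset.mem_filter.2 ⟨hi, hgi⟩⟩)
    obtain ⟨hi₀S, hgi₀⟩ := Finset.mem_filter.1 hi₀
    -- The largest multiple of the relation that can be subtracted while the coefficients on `S`
    -- stay nonnegative; it kills the one at `i₀`.
    set θ := u i₀ / g i₀ with hθ
    have hθ0 : 0 ≤ θ := div_nonneg (hu _) hgi₀.le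
    have hnonneg : ∀ i ∈ S, 0 ≤ u i - θ * g i := by
      intro i hi
      rcases le_or_gt (g i) 0 with h | h
      · nlinarith [hu i, mul_nonneg hθ0 (neg_nonneg.2 h)]
      · have := hmin i (Finset.mem_filter.2 ⟨hi, h⟩)
        rw [le_div_iff₀ h] at this
        linarith
    have hzero : u i₀ - θ * g i₀ = 0 := by
      rw [hθ, div_mul_cancel₀ _ hgi₀.ne', sub_self]
    obtain ⟨U, hU, h1, h2⟩ := ih (S := S.erase i₀) (r := fun i => r i - θ * g i)
      (u := fun i => if i ∈ S then u i - θ * g i else 0)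
      (hTS.mono_right (Finset.erase_subset _ _))
      (fun i => by
        split_ifs with h
        exacts [hnonneg i h, le_rfl])
      (by
        rw [hv, ← sub_zero (∑ i ∈ T, r i • Φ i + ∑ i ∈ S, u i • Φ i), ← smul_zero θ, ← hg0,
          smul_add, Finset.smul_sum, Finset.smul_sum, add_sub_add_comm, ← Finset.sum_sub_distrib,
          ← Finset.sum_sub_distrib, ← Finset.add_sum_erase S _ hi₀S]
        have : u i₀ • Φ i₀ - θ • g i₀ • Φ i₀ = 0 := by rw [smul_smul, ← sub_smul, hzero, zero_smul]
        rw [this, zero_add]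
        congr 1
        · exact Finset.sum_congr rfl fun i _ => by rw [sub_smul, mul_smul]
        · refine Finset.sum_congr rfl fun i hi => ?_
          rw [if_pos (Finset.mem_of_mem_erase hi), sub_smul, mul_smul])
      (by rw [Finset.card_erase_of_mem hi₀S, hn, Nat.add_sub_cancel])
    exact ⟨U, hU.trans (Finset.erase_subset _ _), h1, h2⟩

/-! ### Closed cones, the singular set, and coordinates in a basis -/

section Geometry

variable {V : Type*} [NormedAddCommGroup V] [NormedSpace ℝ V] {N : ℕ}
  {Φ : Fin N → StrongDual ℝ V}

theorem cone_mono {s t : Finset (Fin N)} (h : s ⊆ t) : cone Φ s ⊆ cone Φ t := by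
  rintro a ⟨x, hx, rfl⟩
  refine ⟨fun i => if i ∈ s then x i else 0, fun i => ?_, ?_⟩
  · dsimp only
    split_ifs
    exacts [hx i, le_rfl]
  · simp_rw [ite_smul, zero_smul]
    rw [Finset.sum_ite_mem, Finset.inter_eq_right.2 h]

theorem smul_mem_cone {s : Finset (Fin N)} {a : StrongDual ℝ V} (ha : a ∈ cone Φ s) {r : ℝ}
    (hr : 0 ≤ r) : r • a ∈ cone Φ s := by
  obtain ⟨x, hx, rfl⟩ := ha
  exact ⟨fun i => r * x i, fun i => mul_nonneg hr (hx i), by simp [Finset.smul_sum, mul_smul]⟩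

theorem smul_mem_cone_iff {s : Finset (Fin N)} {a : StrongDual ℝ V} {r : ℝ} (hr : 0 < r) :
    r • a ∈ cone Φ s ↔ a ∈ cone Φ s := by
  refine ⟨fun h => ?_, fun h => smul_mem_cone h hr.le⟩
  have := smul_mem_cone h (inv_nonneg.2 hr.le)
  rwa [smul_smul, inv_mul_cancel₀ hr.ne', one_smul] at this

theorem exists_linearIndepOn_mem_cone {S : Finset (Fin N)} {a : StrongDual ℝ V}
    (ha : a ∈ cone Φ S) : ∃ U ⊆ S, LinearIndepOn ℝ Φ (U : Set (Fin N)) ∧ a ∈ cone Φ U := by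
  obtain ⟨x, hx, rfl⟩ := ha
  obtain ⟨U, hU, h1, r, u, hu, h2⟩ := exists_linearIndepOn_union (Φ := Φ) (T := ∅) (S := S)
    (r := 0) (u := x) (v := ∑ i ∈ S, x i • Φ i) (by simp) (by simp) hx (by simp)
  exact ⟨U, hU, by simpa using h1, u, hu, by simpa using h2⟩

theorem isClosed_cone_of_linearIndepOn [FiniteDimensional ℝ V] {U : Finset (Fin N)}
    (hU : LinearIndepOn ℝ Φ (U : Set (Fin N))) : IsClosed (cone Φ U) := by
  have hinj : Function.Injective (Fintype.linearCombination ℝ fun i : U => Φ i) :=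
    LinearIndependent.fintypeLinearCombination_injective hU
  have hemb := LinearMap.isClosedEmbedding_of_injective (LinearMap.ker_eq_bot.2 hinj)
  have hcl : IsClosed {x : U → ℝ | ∀ i, 0 ≤ x i} := by
    simp only [ofPred_forall]
    exact isClosed_iInter fun i => isClosed_le continuous_const (continuous_apply i)
  convert hemb.isClosedMap _ hcl using 1
  ext a
  constructor
  · rintro ⟨x, hx, rfl⟩
    refine ⟨fun i => x i, fun i => hx i, ?_⟩
    rw [Fintype.linearCombination_apply, Finset.sum_coe_sort U fun i => x i • Φ i]
  · rintro ⟨x, hx, rfl⟩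
    refine ⟨fun i => if h : i ∈ U then x ⟨i, h⟩ else 0, fun i => ?_, ?_⟩
    · dsimp only
      split_ifs with h
      exacts [hx ⟨i, h⟩, le_rfl]
    · rw [Fintype.linearCombination_apply, ← Finset.sum_coe_sort U]
      exact Finset.sum_congr rfl fun i _ => by simp

/-- By Carathéodory the cone is a finite union of simplicial cones, each the image of a closed
orthant under a closed embedding. -/
theorem isClosed_cone [FiniteDimensional ℝ V] (S : Finset (Fin N)) : IsClosed (cone Φ S) := by
  have : cone Φ S = ⋃ U ∈ {U : Finset (Fin N) | U ⊆ S ∧ LinearIndepOn ℝ Φ (U : Set (Fin N))},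
      cone Φ U := by
    ext a
    simp only [mem_iUnion, mem_ofPred_eq, exists_prop]
    constructor
    · intro ha
      obtain ⟨U, h1, h2, h3⟩ := exists_linearIndepOn_mem_cone ha
      exact ⟨U, ⟨h1, h2⟩, h3⟩
    · rintro ⟨U, ⟨h1, -⟩, h3⟩
      exact cone_mono h1 h3
  rw [this]
  exact (Set.toFinite _).isClosed_biUnion fun U hU => isClosed_cone_of_linearIndepOn hU.2

theorem isClosed_singularSet [FiniteDimensional ℝ V] : IsClosed (singularSet Φ) := by
  have : singularSet Φ = ⋃ s ∈ {s : Finset (Fin N) | s.card < finrank ℝ V}, cone Φ s := by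
    ext a
    simp [singularSet]
  rw [this]
  exact (Set.toFinite _).isClosed_biUnion fun s _ => isClosed_cone s

theorem finrank_strongDual [FiniteDimensional ℝ V] :
    finrank ℝ (StrongDual ℝ V) = finrank ℝ V := by
  rw [← LinearEquiv.finrank_eq (LinearMap.toContinuousLinearMap (𝕜 := ℝ) (E := V) (F' := ℝ))]
  exact Subspace.dual_finrank_eq

section Basis

variable [FiniteDimensional ℝ V] {σ : Finset (Fin N)}

/-- The basis of `V*` formed by the `Φ i`, `i ∈ σ`. -/
noncomputable def IsBasis.basis (h : IsBasis Φ σ) : Basis σ ℝ (StrongDual ℝ V) :=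
  Basis.mk h.2 (h.2.span_eq_top_of_card_eq_finrank' (by
    rw [Fintype.card_coe, h.1, finrank_strongDual])).ge

@[simp]
theorem IsBasis.basis_apply (h : IsBasis Φ σ) (i : σ) : h.basis i = Φ i := by
  simp [IsBasis.basis]

/-- The coordinates in the basis `σ`, extended by zero. -/
noncomputable def IsBasis.coord (h : IsBasis Φ σ) : StrongDual ℝ V →ₗ[ℝ] Fin N → ℝ :=
  LinearMap.pi fun i => if hi : i ∈ σ then h.basis.coord ⟨i, hi⟩ else 0

theorem IsBasis.coord_apply (h : IsBasis Φ σ) (a : StrongDual ℝ V) {i : Fin N} (hi : i ∈ σ) :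
    h.coord a i = h.basis.repr a ⟨i, hi⟩ := by
  simp [IsBasis.coord, hi]

theorem IsBasis.sum_coord (h : IsBasis Φ σ) (a : StrongDual ℝ V) :
    ∑ i ∈ σ, h.coord a i • Φ i = a := by
  conv_rhs => rw [← h.basis.sum_repr a]
  rw [← Finset.sum_coe_sort σ]
  exact Finset.sum_congr rfl fun i _ => by rw [h.coord_apply a i.2, h.basis_apply]

theorem IsBasis.coord_sum (h : IsBasis Φ σ) (t : Fin N → ℝ) {i : Fin N} (hi : i ∈ σ) :
    h.coord (∑ j ∈ σ, t j • Φ j) i = t i := by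
  rw [h.coord_apply _ hi, ← Finset.sum_coe_sort σ]
  have : ∑ j : σ, t j • Φ j = ∑ j : σ, t j • h.basis j := by simp
  rw [this, h.basis.repr_sum_self fun j : σ => t j]

theorem IsBasis.continuous_coord (h : IsBasis Φ σ) (i : Fin N) :
    Continuous fun a => h.coord a i :=
  (continuous_apply i).comp (LinearMap.continuous_of_finiteDimensional h.coord)

theorem IsBasis.mem_cone_iff (h : IsBasis Φ σ) {a : StrongDual ℝ V} :
    a ∈ cone Φ σ ↔ ∀ i ∈ σ, 0 ≤ h.coord a i := by
  constructor
  · rintro ⟨t, ht, rfl⟩ i hi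
    rw [h.coord_sum t hi]
    exact ht i
  · intro ha
    refine ⟨fun i => |h.coord a i|, fun i => abs_nonneg _, ?_⟩
    conv_lhs => rw [← h.sum_coord a]
    exact Finset.sum_congr rfl fun i hi => by simp only [abs_of_nonneg (ha i hi)]

/-- A zero coordinate would put `a` on a facet, which is generated by only n - 1 elements of `Φ`. -/
theorem IsBasis.coord_pos (h : IsBasis Φ σ) {a : StrongDual ℝ V} (ha : a ∈ cone Φ σ)
    (hreg : a ∉ singularSet Φ) {i : Fin N} (hi : i ∈ σ) : 0 < h.coord a i := by
  refine (h.mem_cone_iff.1 ha i hi).lt_of_ne fun h0 => hreg ⟨σ.erase i, ?_, ?_⟩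
  · rw [← h.1]
    exact Finset.card_erase_lt_of_mem hi
  · refine ⟨fun j => |h.coord a j|, fun _ => abs_nonneg _, ?_⟩
    conv_lhs => rw [← h.sum_coord a, ← Finset.add_sum_erase _ _ hi, ← h0, zero_smul, zero_add]
    refine Finset.sum_congr rfl fun j hj => ?_
    simp only [abs_of_nonneg (h.mem_cone_iff.1 ha j (Finset.mem_of_mem_erase hj))]

end Basis

theorem isBasis_of_mem_cone [FiniteDimensional ℝ V] {U : Finset (Fin N)}
    (hU : LinearIndepOn ℝ Φ (U : Set (Fin N))) {a : StrongDual ℝ V} (ha : a ∈ cone Φ U)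
    (hreg : a ∉ singularSet Φ) : IsBasis Φ U := by
  refine ⟨le_antisymm ?_ ?_, hU⟩
  · have := LinearIndependent.fintype_card_le_finrank (R := ℝ) (b := fun i : U => Φ i) hU
    rwa [Fintype.card_coe, finrank_strongDual] at this
  · by_contra! hlt
    exact hreg ⟨U, hlt, ha⟩

end Geometry

end PartitionPolytope

namespace PartitionPolytope

/-! ### Chambers and their closures -/

section Chamber

variable {V : Type*} [NormedAddCommGroup V] [NormedSpace ℝ V]
  {N : ℕ} {Φ : Fin N → StrongDual ℝ V} {c : Set (StrongDual ℝ V)}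

theorem IsChamber.notMem_singularSet (hc : IsChamber Φ c) {a : StrongDual ℝ V} (ha : a ∈ c) :
    a ∉ singularSet Φ := by
  obtain ⟨b, -, rfl⟩ := hc
  exact connectedComponentIn_subset _ _ ha

theorem IsChamber.isPreconnected (hc : IsChamber Φ c) : IsPreconnected c := by
  obtain ⟨b, -, rfl⟩ := hc
  exact isPreconnected_connectedComponentIn

theorem IsChamber.nonempty (hc : IsChamber Φ c) : c.Nonempty := by
  obtain ⟨b, hb, rfl⟩ := hc
  exact ⟨b, mem_connectedComponentIn hb⟩

theorem IsChamber.subset_of_isPreconnected (hc : IsChamber Φ c) {s : Set (StrongDual ℝ V)}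
    (hs : IsPreconnected s) (hreg : s ⊆ (singularSet Φ)ᶜ) {a : StrongDual ℝ V} (hac : a ∈ c)
    (has : a ∈ s) : s ⊆ c := by
  obtain ⟨b, -, rfl⟩ := hc
  rw [connectedComponentIn_eq hac]
  exact hs.subset_connectedComponentIn has hreg

theorem smul_mem_singularSet_iff {a : StrongDual ℝ V} {r : ℝ} (hr : 0 < r) :
    r • a ∈ singularSet Φ ↔ a ∈ singularSet Φ := by
  simp only [singularSet, mem_ofPred_eq, smul_mem_cone_iff hr]

theorem IsChamber.smul_mem (hc : IsChamber Φ c) {a : StrongDual ℝ V} (ha : a ∈ c) {r : ℝ}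
    (hr : 0 < r) : r • a ∈ c := by
  have hs : IsPreconnected ((fun t : ℝ => t • a) '' Ioi 0) :=
    isPreconnected_Ioi.image _ (by fun_prop)
  refine hc.subset_of_isPreconnected hs ?_ ha ⟨1, zero_lt_one' ℝ, one_smul _ _⟩ ⟨r, hr, rfl⟩
  rintro _ ⟨t, ht, rfl⟩
  exact fun h => hc.notMem_singularSet ha ((smul_mem_singularSet_iff ht).1 h)

theorem mem_chamberBases {σ : Finset (Fin N)} :
    σ ∈ chamberBases Φ c ↔ IsBasis Φ σ ∧ c ⊆ cone Φ σ := by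
  simp [chamberBases]

variable [FiniteDimensional ℝ V]

theorem IsChamber.isOpen (hc : IsChamber Φ c) : IsOpen c := by
  obtain ⟨b, -, rfl⟩ := hc
  exact isClosed_singularSet.isOpen_compl.connectedComponentIn

/-- The boundary of the cone of `σ` is singular, so the connected set `c` is covered by two disjoint
open sets: the points with all coordinates positive and the complement of the cone. -/
theorem IsChamber.subset_cone (hc : IsChamber Φ c) {σ : Finset (Fin N)} (hσ : IsBasis Φ σ)
    {a : StrongDual ℝ V} (ha : a ∈ c) (haσ : a ∈ cone Φ σ) : c ⊆ cone Φ σ := by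
  have hopen : IsOpen {a | ∀ i ∈ σ, 0 < hσ.coord a i} := by
    have : {a | ∀ i ∈ σ, 0 < hσ.coord a i} = ⋂ i ∈ σ, {a | 0 < hσ.coord a i} := by
      ext
      simp
    rw [this]
    exact isOpen_biInter_finset fun i _ => isOpen_lt continuous_const (hσ.continuous_coord i)
  have hsub := hc.isPreconnected.subset_left_of_subset_union hopen
    (isClosed_cone (Φ := Φ) σ).isOpen_compl ?_ ?_ ?_
  · exact fun b hb => hσ.mem_cone_iff.2 fun i hi => (hsub hb i hi).le
  · refine disjoint_compl_right_iff_subset.2 fun b hb => ?_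
    exact hσ.mem_cone_iff.2 fun i hi => (hb i hi).le
  · intro b hb
    by_cases h : b ∈ cone Φ σ
    · exact Or.inl fun i hi => hσ.coord_pos h (hc.notMem_singularSet hb) hi
    · exact Or.inr h
  · exact ⟨a, ha, fun i hi => hσ.coord_pos haσ (hc.notMem_singularSet ha) hi⟩

theorem IsChamber.exists_mem_chamberBases (hc : IsChamber Φ c) {S : Finset (Fin N)}
    {a : StrongDual ℝ V} (ha : a ∈ c) (haS : a ∈ cone Φ S) : ∃ σ ⊆ S, σ ∈ chamberBases Φ c := by
  obtain ⟨U, hU, hli, haU⟩ := exists_linearIndepOn_mem_cone haS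
  have hb := isBasis_of_mem_cone hli haU (hc.notMem_singularSet ha)
  exact ⟨U, hU, mem_chamberBases.2 ⟨hb, hc.subset_cone hb ha haU⟩⟩

/-- A point at which all bases of the chamber have positive coordinates cannot be the first
singular point on a segment that starts in the chamber. -/
theorem IsChamber.notMem_singularSet_of_segment (hc : IsChamber Φ c)
    (hcone : c ⊆ cone Φ Finset.univ) {v z : StrongDual ℝ V} (hv : v ∈ c)
    (hz : ∀ σ (hσ : IsBasis Φ σ), c ⊆ cone Φ σ → ∀ i ∈ σ, 0 < hσ.coord z i)
    (hseg : ∀ s : ℝ, 0 < s → s ≤ 1 → (1 - s) • z + s • v ∈ c) : z ∉ singularSet Φ := by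
  rintro ⟨T₀, hT₀, hzT₀⟩
  obtain ⟨T₁, hT₁, hli, t, ht, hzt⟩ := exists_linearIndepOn_mem_cone hzT₀
  have hcard₁ : T₁.card < finrank ℝ V := (Finset.card_le_card hT₁).trans_lt hT₀
  obtain ⟨T, hTdef⟩ : ∃ T, T = T₁.filter fun i => 0 < t i := ⟨_, rfl⟩
  have hTT : T ⊆ T₁ := hTdef ▸ Finset.filter_subset _ _
  have hzT : z = ∑ i ∈ T, t i • Φ i := by
    rw [hzt, hTdef, Finset.sum_filter_of_ne]
    intro i _ hi
    refine (ht i).lt_of_ne fun h => hi ?_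
    rw [← h, zero_smul]
  have htpos : ∀ i ∈ T, 0 < t i := fun i hi => by
    rw [hTdef] at hi
    exact (Finset.mem_filter.1 hi).2
  have hliT : LinearIndepOn ℝ Φ (T : Set (Fin N)) := hli.mono (by exact_mod_cast hTT)
  obtain ⟨x, hx, hvx⟩ := hcone hv
  -- The coefficients `r` of `v` on `T` may be negative; near `z`, where those on `T` are strictly
  -- positive, this does no harm.
  obtain ⟨U, hU, hTU, r, u, hu, hvu⟩ := exists_linearIndepOn_union hliT (S := Finset.univ \ T)
    Finset.disjoint_sdiff (r := x) (u := x) hx (v := v) (by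
      rw [hvx, add_comm, Finset.sum_sdiff (Finset.subset_univ T)])
  have hdisj : Disjoint T U := Finset.disjoint_sdiff.mono_right hU
  obtain ⟨s, hs0, hs1, hs⟩ : ∃ s : ℝ, 0 < s ∧ s ≤ 1 ∧ ∀ i ∈ T, 0 ≤ (1 - s) * t i + s * r i := by
    have hev : ∀ᶠ s : ℝ in nhdsWithin 0 (Ioi 0), ∀ i ∈ T, 0 ≤ (1 - s) * t i + s * r i := by
      rw [Finset.eventually_all]
      intro i hi
      have hcont : Continuous fun s : ℝ => (1 - s) * t i + s * r i := by fun_prop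
      have hlt : 0 < (fun s : ℝ => (1 - s) * t i + s * r i) 0 := by simpa using htpos i hi
      exact ((hcont.tendsto 0).eventually (lt_mem_nhds hlt)).filter_mono nhdsWithin_le_nhds
        |>.mono fun s hs => hs.le
    obtain ⟨s, hs, hs0, hs1⟩ := (hev.and (Ioc_mem_nhdsGT (zero_lt_one' ℝ))).exists
    exact ⟨s, hs0, hs1, hs⟩
  have hmem : (1 - s) • z + s • v ∈ cone Φ (T ∪ U) := by
    refine ⟨fun i => if i ∈ T then |(1 - s) * t i + s * r i| else s * u i, fun i => ?_, ?_⟩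
    · dsimp only
      split_ifs
      exacts [abs_nonneg _, mul_nonneg hs0.le (hu i)]
    · have h1 : ∀ i ∈ T, (if i ∈ T then |(1 - s) * t i + s * r i| else s * u i) • Φ i =
          (1 - s) • t i • Φ i + s • r i • Φ i := fun i hi => by
        rw [if_pos hi, abs_of_nonneg (hs i hi)]
        module
      have h2 : ∀ i ∈ U, (if i ∈ T then |(1 - s) * t i + s * r i| else s * u i) • Φ i =
          s • u i • Φ i := fun i hi => by
        rw [if_neg (Finset.disjoint_right.1 hdisj hi)]
        module
      rw [Finset.sum_union hdisj, Finset.sum_congr rfl h1, Finset.sum_congr rfl h2, hvu, hzT,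
        Finset.sum_add_distrib, ← Finset.smul_sum, ← Finset.smul_sum, ← Finset.smul_sum, smul_add,
        add_assoc]
  have hsc := hseg s hs0 hs1
  have hb := isBasis_of_mem_cone hTU hmem (hc.notMem_singularSet hsc)
  obtain ⟨i, hi⟩ : U.Nonempty := by
    rw [Finset.nonempty_iff_ne_empty]
    rintro rfl
    have := hb.1
    rw [Finset.union_empty] at this
    exact absurd ((Finset.card_le_card hTT).trans_lt hcard₁) (by rw [this]; exact lt_irrefl _)
  have hpos := hz _ hb (hc.subset_cone hb hsc hmem) i (Finset.mem_union_right _ hi)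
  -- Since `T ∪ U` is a basis of the chamber, `z` should have positive coordinates on `U`; but `z`
  -- is a combination of `T` alone.
  have hzero : z = ∑ j ∈ T ∪ U, (if j ∈ T then t j else 0) • Φ j := by
    simp_rw [ite_smul, zero_smul]
    rw [Finset.sum_ite_mem, Finset.union_inter_cancel_left, hzT]
  rw [hzero, hb.coord_sum _ (Finset.mem_union_right _ hi),
    if_neg (Finset.disjoint_right.1 hdisj hi)] at hpos
  exact lt_irrefl _ hpos

/-- On a segment from a point of `c` to `x`, the first point outside `c` still has positive
coordinates in every basis of the chamber. It is therefore regular, and the segment up to it lies in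
one connected component. -/
theorem IsChamber.mem_of_forall_coord_pos (hc : IsChamber Φ c)
    (hcone : c ⊆ cone Φ Finset.univ) {x : StrongDual ℝ V}
    (hx : ∀ σ (hσ : IsBasis Φ σ), c ⊆ cone Φ σ → ∀ i ∈ σ, 0 < hσ.coord x i) : x ∈ c := by
  obtain ⟨v, hv⟩ := hc.nonempty
  by_contra hxc
  have hcont : Continuous fun s : ℝ => (1 - s) • v + s • x := by fun_prop
  have hcompact : IsCompact (Icc (0 : ℝ) 1 ∩ (fun s : ℝ => (1 - s) • v + s • x) ⁻¹' cᶜ) :=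
    isCompact_Icc.inter_right (hc.isOpen.isClosed_compl.preimage hcont)
  obtain ⟨s₀, ⟨⟨hs₀0, hs₀1⟩, hs₀c⟩, hleast⟩ :=
    hcompact.exists_isLeast ⟨1, by simp, by simpa using hxc⟩
  have hlt : ∀ s, 0 ≤ s → s < s₀ → (1 - s) • v + s • x ∈ c := by
    intro s hs hss
    by_contra hsc
    exact absurd (hleast ⟨⟨hs, hss.le.trans hs₀1⟩, hsc⟩) (not_le.2 hss)
  have hs₀pos : 0 < s₀ := by
    refine hs₀0.lt_of_ne ?_
    rintro rfl
    simp [hv] at hs₀c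
  have hreg := hc.notMem_singularSet_of_segment hcone (z := (1 - s₀) • v + s₀ • x) hv ?_ ?_
  · refine hs₀c (hc.subset_of_isPreconnected
      ((isPreconnected_Icc (a := (0 : ℝ)) (b := s₀)).image _ hcont.continuousOn) ?_ hv
      ⟨0, ⟨le_rfl, hs₀0⟩, by simp⟩ ⟨s₀, ⟨hs₀0, le_rfl⟩, rfl⟩)
    rintro _ ⟨s, ⟨h0, h1⟩, rfl⟩
    rcases h1.lt_or_eq with h | rfl
    · exact hc.notMem_singularSet (hlt s h0 h)
    · exact hreg
  · intro σ hσ hcσ i hi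
    have h1 := hσ.coord_pos (hcσ hv) (hc.notMem_singularSet hv) hi
    have h2 := hx σ hσ hcσ i hi
    simp only [map_add, map_smul, Pi.add_apply, Pi.smul_apply, smul_eq_mul]
    have := mul_nonneg (sub_nonneg.2 hs₀1) h1.le
    have := mul_pos hs₀pos h2
    linarith
  · intro s hs hs1
    have := hlt ((1 - s) * s₀) (mul_nonneg (sub_nonneg.2 hs1) hs₀0) (by nlinarith)
    convert this using 1
    module

theorem IsChamber.closure_subset (hc : IsChamber Φ c) (hcone : c ⊆ cone Φ Finset.univ) :
    closure c ⊆ c - box Φ := by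
  intro x hx
  obtain ⟨v, hv⟩ := hc.nonempty
  obtain ⟨t, ht, hvt⟩ := hcone hv
  have hT : 0 < 1 + ∑ i, t i := add_pos_of_pos_of_nonneg one_pos (Finset.sum_nonneg fun i _ => ht i)
  have hε : 0 < (1 + ∑ i, t i)⁻¹ := inv_pos.2 hT
  -- Adding a multiple of `v` makes the nonnegative coordinates of `x` positive; the factor brings
  -- the coefficients of `v` into [0,1].
  refine ⟨x + (1 + ∑ i, t i)⁻¹ • v, ?_, (1 + ∑ i, t i)⁻¹ • v, ?_, by simp⟩
  · refine hc.mem_of_forall_coord_pos hcone fun σ hσ hcσ i hi => ?_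
    have h1 := hσ.coord_pos (hcσ hv) (hc.notMem_singularSet hv) hi
    have h2 := hσ.mem_cone_iff.1 (closure_minimal hcσ (isClosed_cone σ) hx) i hi
    simp only [map_add, map_smul, Pi.add_apply, Pi.smul_apply, smul_eq_mul]
    have := mul_pos hε h1
    linarith
  · rw [box, mem_parallelepiped_iff]
    refine ⟨fun i => (1 + ∑ i, t i)⁻¹ * t i, ⟨fun i => mul_nonneg hε.le (ht i), fun i => ?_⟩, ?_⟩
    · change (1 + ∑ i, t i)⁻¹ * t i ≤ 1
      rw [inv_mul_eq_div]
      refine div_le_one_of_le₀ ?_ hT.le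
      have := Finset.single_le_sum (f := t) (fun j _ => ht j) (Finset.mem_univ i)
      linarith
    · rw [hvt, Finset.smul_sum]
      exact Finset.sum_congr rfl fun i _ => smul_smul _ _ _

end Chamber

end PartitionPolytope

namespace PartitionPolytope

/-! ### The volume of a basis as a lattice index -/

section Index

variable {V : Type*} [NormedAddCommGroup V] [NormedSpace ℝ V] [FiniteDimensional ℝ V]
  {N : ℕ} {Φ : Fin N → StrongDual ℝ V} {σ : Finset (Fin N)}

/-- The basis of `V` dual to the basis `σ` of `V*`. -/
noncomputable def IsBasis.predual (h : IsBasis Φ σ) : Basis σ ℝ V :=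
  (h.basis.map LinearMap.toContinuousLinearMap.symm).dualBasis.map (evalEquiv ℝ V).symm

theorem IsBasis.apply_predual (h : IsBasis Φ σ) (a : StrongDual ℝ V) (j : σ) :
    a (h.predual j) = h.coord a j := by
  have : a (h.predual j) = (a : V →ₗ[ℝ] ℝ) (h.predual j) := rfl
  rw [this, IsBasis.predual, Basis.map_apply, apply_evalEquiv_symm_apply, Basis.dualBasis_apply,
    h.coord_apply a j.2]
  rfl

theorem IsBasis.coord_self (h : IsBasis Φ σ) (i j : σ) :
    h.coord (Φ i) j = if i = j then 1 else 0 := by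
  rw [h.coord_apply _ j.2, ← h.basis_apply, h.basis.repr_self, Finsupp.single_apply]

theorem IsBasis.predual_repr (h : IsBasis Φ σ) (v : V) (i : σ) :
    h.predual.repr v i = Φ i v := by
  conv_rhs => rw [← h.predual.sum_repr v, map_sum]
  simp [h.apply_predual, h.coord_self]

theorem IsBasis.sum_predual (h : IsBasis Φ σ) (v : V) :
    ∑ i : σ, Φ i v • h.predual i = v := by
  conv_rhs => rw [← h.predual.sum_repr v]
  simp_rw [h.predual_repr]

/-- The lattice of `V` on which all `Φ i`, `i ∈ σ`, take integer values. -/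
noncomputable def IsBasis.lattice (h : IsBasis Φ σ) : Submodule ℤ V :=
  Submodule.span ℤ (Set.range h.predual)

theorem IsBasis.mem_lattice (h : IsBasis Φ σ) {v : V} :
    v ∈ h.lattice ↔ ∀ i ∈ σ, ∃ m : ℤ, Φ i v = m := by
  rw [IsBasis.lattice, Basis.mem_span_iff_repr_mem]
  simp [h.predual_repr, eq_comm]

theorem IsBasis.predual_mem_lattice (h : IsBasis Φ σ) (j : σ) : h.predual j ∈ h.lattice :=
  Submodule.subset_span ⟨j, rfl⟩

variable {Γ : Submodule ℤ V}

theorem IsBasis.le_lattice (h : IsBasis Φ σ) (hΦ : ∀ k, Φ k ∈ dualLattice Γ) : Γ ≤ h.lattice :=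
  fun _ hγ => h.mem_lattice.2 fun i _ => hΦ i _ hγ

variable [DiscreteTopology Γ] [IsZLattice ℝ Γ]

theorem exists_latticeBasis (h : IsBasis Φ σ) : Nonempty (Basis σ ℤ Γ) := by
  have : Module.Free ℤ Γ := ZLattice.module_free ℝ Γ
  have : Module.Finite ℤ Γ := ZLattice.module_finite ℝ Γ
  refine ⟨(finBasisOfFinrankEq ℤ Γ (n := σ.card) ?_).reindex σ.equivFin.symm⟩
  rw [ZLattice.rank ℝ, h.1]

theorem dualLattice_eq_span (b : Basis σ ℤ Γ) :
    dualLattice Γ = Submodule.span ℤ (Set.range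
      ((b.ofZLatticeBasis ℝ Γ).dualBasis.map LinearMap.toContinuousLinearMap)) := by
  ext f
  rw [Basis.mem_span_iff_repr_mem]
  have hrepr : ∀ i, ((b.ofZLatticeBasis ℝ Γ).dualBasis.map
      LinearMap.toContinuousLinearMap).repr f i = f (b i) := by
    intro i
    rw [Basis.map_repr, LinearEquiv.trans_apply, Basis.dualBasis_repr, Basis.ofZLatticeBasis_apply]
    rfl
  simp only [hrepr]
  constructor
  · intro hf i
    obtain ⟨m, hm⟩ := hf (b i) (b i).2
    exact ⟨m, hm.symm⟩
  · intro hf γ hγ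
    choose m hm using hf
    have : γ = ((∑ i, b.repr ⟨γ, hγ⟩ i • b i : Γ) : V) := by rw [b.sum_repr]
    refine ⟨∑ i, b.repr ⟨γ, hγ⟩ i * m i, ?_⟩
    conv_lhs => rw [this]
    simp [← hm]

/-- The two matrices are transposes of each other: their entries are the values of the `Φ i` on the
vectors of `b`. -/
theorem IsBasis.det_predual (h : IsBasis Φ σ) (b : Basis σ ℤ Γ) :
    h.predual.det (b.ofZLatticeBasis ℝ Γ) =
      ((b.ofZLatticeBasis ℝ Γ).dualBasis.map LinearMap.toContinuousLinearMap).det h.basis := by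
  rw [Basis.det_apply, Basis.det_apply, ← Matrix.det_transpose]
  congr 1
  ext i j
  rw [Matrix.transpose_apply, Basis.toMatrix_apply, Basis.toMatrix_apply, h.predual_repr,
    Basis.map_repr, LinearEquiv.trans_apply, Basis.dualBasis_repr, h.basis_apply]
  rfl

theorem IsBasis.relIndex_eq (h : IsBasis Φ σ) (hΦ : ∀ k, Φ k ∈ dualLattice Γ) (b : Basis σ ℤ Γ) :
    (Γ.toAddSubgroup.relIndex h.lattice.toAddSubgroup : ℝ) =
      |h.predual.det (b.ofZLatticeBasis ℝ Γ)| := by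
  let b₂ : Basis σ ℤ h.lattice := h.predual.restrictScalars ℤ
  rw [AddSubgroup.relIndex_eq_natAbs_det Γ.toAddSubgroup h.lattice.toAddSubgroup
    (h.le_lattice hΦ) b b₂, Nat.cast_natAbs, Int.cast_abs]
  change |((b₂.det fun i => (⟨b i, h.le_lattice hΦ (b i).2⟩ : h.lattice) : ℤ) : ℝ)| = _
  rw [Basis.det_apply, Basis.det_apply, Int.cast_det]
  congr 2
  ext i j
  rw [Matrix.map_apply, Basis.toMatrix_apply, Basis.toMatrix_apply, Basis.ofZLatticeBasis_apply]
  exact h.predual.restrictScalars_repr_apply ℤ ⟨b j, h.le_lattice hΦ (b j).2⟩ i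

theorem IsBasis.relIndex_ne_zero (h : IsBasis Φ σ) (hΦ : ∀ k, Φ k ∈ dualLattice Γ) :
    Γ.toAddSubgroup.relIndex h.lattice.toAddSubgroup ≠ 0 := by
  obtain ⟨b⟩ := exists_latticeBasis (Γ := Γ) h
  have h1 := h.relIndex_eq hΦ b
  have h2 := (h.predual.isUnit_det (b.ofZLatticeBasis ℝ Γ)).ne_zero
  intro h0
  rw [h0, Nat.cast_zero] at h1
  exact h2 (abs_eq_zero.1 h1.symm)

/-- Relative to the covolume of `Γ*`, the parallelepiped measures the determinant of `σ` in a basis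
of `Γ*`. By duality this is, up to sign, the determinant of a basis of `Γ` in the lattice dual to
`σ`, hence the index. -/
theorem IsBasis.basisVolume_eq (h : IsBasis Φ σ) (hΦ : ∀ k, Φ k ∈ dualLattice Γ) :
    basisVolume Γ Φ σ = (Γ.toAddSubgroup.relIndex h.lattice.toAddSubgroup : ℝ) := by
  obtain ⟨b⟩ := exists_latticeBasis (Γ := Γ) h
  rw [h.relIndex_eq hΦ b, h.det_predual b, basisVolume, latticeVolume, dualLattice_eq_span b]
  set bd := (b.ofZLatticeBasis ℝ Γ).dualBasis.map LinearMap.toContinuousLinearMap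
  have hcov := ZLattice.covolume_eq_measure_fundamentalDomain _ Measure.addHaar
    (ZSpan.isAddFundamentalDomain bd Measure.addHaar)
  have hpos := ZLattice.covolume_pos (Submodule.span ℤ (Set.range bd)) Measure.addHaar
  have hpar : (Measure.addHaar : Measure (StrongDual ℝ V)).real
      (parallelepiped fun i : σ => Φ i) = |bd.det h.basis| *
        ZLattice.covolume (Submodule.span ℤ (Set.range bd)) Measure.addHaar := by
    have : (fun i : σ => Φ i) = h.basis := by
      ext1 i
      simp
    rw [this, ← measureReal_congr (ZSpan.fundamentalDomain_ae_parallelepiped h.basis _),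
      ZSpan.measureReal_fundamentalDomain _ _ bd, hcov]
  rw [measureReal_ennreal_smul_apply, hpar, ENNReal.toReal_inv, ENNReal.toReal_ofReal hpos.le]
  field_simp

end Index

end PartitionPolytope

namespace PartitionPolytope

/-! ### The points of G(σ, y, Γ) and the character sum over them -/

section Poles

open Complex

variable {V : Type*} [NormedAddCommGroup V] [NormedSpace ℝ V]

theorem pair_tmul (f : StrongDual ℝ V) (z : ℂ) (v : V) : pair f (z ⊗ₜ[ℝ] v) = z * f v := by
  simp [pair, LinearMap.liftBaseChange_tmul]

theorem pair_add_left (f g : StrongDual ℝ V) (p : Complexified V) :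
    pair (f + g) p = pair f p + pair g p := by
  induction p using TensorProduct.induction_on with
  | zero => simp
  | tmul z v => simp [pair_tmul, mul_add]
  | add p q hp hq => rw [map_add, map_add, map_add, hp, hq]; ring

theorem pair_smul_left (r : ℝ) (f : StrongDual ℝ V) (p : Complexified V) :
    pair (r • f) p = r * pair f p := by
  induction p using TensorProduct.induction_on with
  | zero => simp
  | tmul z v =>
    simp only [pair_tmul, smul_apply, smul_eq_mul, ofReal_mul]
    ring
  | add p q hp hq => rw [map_add, map_add, hp, hq]; ring

theorem pair_sub_left (f g : StrongDual ℝ V) (p : Complexified V) :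
    pair (f - g) p = pair f p - pair g p := by
  rw [eq_sub_iff_add_eq, ← pair_add_left, sub_add_cancel]

theorem pair_zero_left (p : Complexified V) : pair (0 : StrongDual ℝ V) p = 0 := by
  simpa using pair_smul_left 0 (0 : StrongDual ℝ V) p

theorem pair_sum_left {ι : Type*} (s : Finset ι) (f : ι → StrongDual ℝ V) (p : Complexified V) :
    pair (∑ i ∈ s, f i) p = ∑ i ∈ s, pair (f i) p :=
  map_sum (⟨⟨fun f => pair f p, pair_zero_left p⟩, fun f g => pair_add_left f g p⟩ :
    StrongDual ℝ V →+ ℂ) f s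

variable {N : ℕ} {Φ : Fin N → StrongDual ℝ V} {σ : Finset (Fin N)}
  {y : Fin N → ℂ}

theorem tmul_mem_twoPiILattice_iff {Γ : Submodule ℤ V} [FiniteDimensional ℝ V]
    (h : IsBasis Φ σ) {v : V} :
    (2 * (Real.pi : ℂ) * I) ⊗ₜ[ℝ] v ∈ twoPiILattice Γ ↔ v ∈ Γ := by
  refine ⟨?_, fun hv => ⟨v, hv, rfl⟩⟩
  rintro ⟨γ, hγ, heq⟩
  suffices v = γ by rwa [this]
  refine h.predual.ext_elem fun i => ?_
  rw [h.predual_repr, h.predual_repr]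
  have := congrArg (pair (Φ i)) heq
  rw [pair_tmul, pair_tmul] at this
  exact_mod_cast mul_left_cancel₀ two_pi_I_ne_zero this

/-- For an integral combination of `σ` the exponential does not depend on the chosen pole `p`. -/
theorem exp_neg_pair {p : Complexified V} (hp : p ∈ polePoints Φ y σ)
    {m : Fin N → ℤ} {lam : StrongDual ℝ V} (hlam : lam = ∑ j ∈ σ, (m j : ℝ) • Φ j) :
    exp (-pair lam p) = exp (∑ j ∈ σ, y j * m j) := by
  rw [hlam, pair_sum_left, ← Finset.sum_neg_distrib, exp_sum, exp_sum]
  refine Finset.prod_congr rfl fun j hj => ?_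
  rw [pair_smul_left, ofReal_intCast, exp_neg, exp_int_mul, hp j hj, ← exp_int_mul, ← exp_neg]
  congr 1
  ring

variable [FiniteDimensional ℝ V]

theorem IsBasis.sum_tmul_predual (h : IsBasis Φ σ) (p : Complexified V) :
    ∑ i : σ, pair (Φ i) p ⊗ₜ[ℝ] h.predual i = p := by
  induction p using TensorProduct.induction_on with
  | zero => simp
  | tmul z v =>
    conv_rhs => rw [← h.sum_predual v, TensorProduct.tmul_sum]
    refine Finset.sum_congr rfl fun i _ => ?_
    rw [pair_tmul, TensorProduct.tmul_smul, TensorProduct.smul_tmul', Complex.real_smul, mul_comm]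
  | add p q hp hq =>
    conv_rhs => rw [← hp, ← hq, ← Finset.sum_add_distrib]
    refine Finset.sum_congr rfl fun i _ => ?_
    rw [map_add, TensorProduct.add_tmul]

theorem IsBasis.pair_sum_tmul (h : IsBasis Φ σ) (z : σ → ℂ) (j : σ) :
    pair (Φ j) (∑ i : σ, z i ⊗ₜ[ℝ] h.predual i) = z j := by
  rw [map_sum, Finset.sum_eq_single j]
  · simp [pair_tmul, h.apply_predual, h.coord_self]
  · intro i _ hij
    simp [pair_tmul, h.apply_predual, h.coord_self, hij.symm]
  · simp

theorem IsBasis.polePoints_nonempty (h : IsBasis Φ σ) (y : Fin N → ℂ) :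
    (polePoints Φ y σ).Nonempty :=
  ⟨∑ i : σ, (-y i) ⊗ₜ[ℝ] h.predual i, fun j hj => by
    rw [h.pair_sum_tmul (fun i => -y i) ⟨j, hj⟩]⟩

theorem IsBasis.exists_sub_eq (h : IsBasis Φ σ) {p q : Complexified V}
    (hp : p ∈ polePoints Φ y σ) (hq : q ∈ polePoints Φ y σ) :
    ∃ v ∈ h.lattice, p - q = (2 * (Real.pi : ℂ) * I) ⊗ₜ[ℝ] v := by
  have hn : ∀ j : σ, ∃ n : ℤ, pair (Φ j) p = pair (Φ j) q + n * (2 * Real.pi * I) := fun j =>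
    exp_eq_exp_iff_exists_int.1 ((hp j j.2).trans (hq j j.2).symm)
  choose n hn using hn
  refine ⟨∑ j, n j • h.predual j,
    Submodule.sum_mem _ fun j _ => Submodule.smul_mem _ _ (h.predual_mem_lattice j), ?_⟩
  rw [← h.sum_tmul_predual (p - q), TensorProduct.tmul_sum]
  refine Finset.sum_congr rfl fun j _ => ?_
  rw [map_sub, hn j, add_sub_cancel_left, ← Int.cast_smul_eq_zsmul ℝ, TensorProduct.tmul_smul,
    TensorProduct.smul_tmul', Complex.real_smul, ofReal_intCast]

theorem IsBasis.add_mem_polePoints (h : IsBasis Φ σ) {p : Complexified V}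
    (hp : p ∈ polePoints Φ y σ) {v : V} (hv : v ∈ h.lattice) :
    p + (2 * (Real.pi : ℂ) * I) ⊗ₜ[ℝ] v ∈ polePoints Φ y σ := by
  intro j hj
  obtain ⟨m, hm⟩ := h.mem_lattice.1 hv j hj
  rw [map_add, pair_tmul, hm, exp_add, hp j hj, ofReal_intCast, mul_comm _ (m : ℂ),
    exp_int_mul_two_pi_mul_I, mul_one]

variable {Γ : Submodule ℤ V}

/-- The finite group that parametrizes the points of `G(σ, y, Γ)` modulo `2πiΓ`. -/
abbrev IsBasis.quotient (h : IsBasis Φ σ) (Γ : Submodule ℤ V) : Type _ :=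
  h.lattice.toAddSubgroup ⧸ Γ.toAddSubgroup.addSubgroupOf h.lattice.toAddSubgroup

/-- The poles form a torsor under 2πi times `h.lattice`; a base pole `p₀` turns a reduced set into a
system of representatives of `h.lattice` modulo `Γ`. -/
theorem IsBasis.exists_bijective (h : IsBasis Φ σ)
    {R : Set (Complexified V)} (hR : IsReducedSet Γ Φ y σ R) {p₀ : Complexified V}
    (hp₀ : p₀ ∈ polePoints Φ y σ) :
    ∃ f : R → h.lattice.toAddSubgroup, (∀ p : R, (p : Complexified V) =
      p₀ + (2 * (Real.pi : ℂ) * I) ⊗ₜ[ℝ] (f p : V)) ∧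
      Function.Bijective fun p => (QuotientAddGroup.mk (f p) : h.quotient Γ) := by
  have hf : ∀ p : R, ∃ v : h.lattice.toAddSubgroup, (p : Complexified V) =
      p₀ + (2 * (Real.pi : ℂ) * I) ⊗ₜ[ℝ] (v : V) := fun p => by
    obtain ⟨v, hv, hpv⟩ := h.exists_sub_eq (hR.1 p.2) hp₀
    exact ⟨⟨v, hv⟩, by rw [← hpv, add_sub_cancel]⟩
  choose f hf using hf
  refine ⟨f, hf, fun p q hpq => ?_, fun x => ?_⟩
  · have hmem := QuotientAddGroup.eq.1 hpq
    rw [AddSubgroup.mem_addSubgroupOf] at hmem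
    obtain ⟨r, -, hr⟩ := hR.2 q (hR.1 q.2)
    have h1 := hr p ⟨p.2, by
      rw [hf p, hf q, add_sub_add_left_eq_sub, ← TensorProduct.tmul_sub,
        tmul_mem_twoPiILattice_iff h, sub_eq_neg_add]
      exact hmem⟩
    have h2 := hr q ⟨q.2, 0, Γ.zero_mem, by simp⟩
    exact Subtype.ext (h1.trans h2.symm)
  · obtain ⟨v, rfl⟩ := QuotientAddGroup.mk_surjective x
    obtain ⟨q, ⟨hqR, hq⟩, -⟩ := hR.2 _ (h.add_mem_polePoints hp₀ v.2)
    refine ⟨⟨q, hqR⟩, QuotientAddGroup.eq.2 ?_⟩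
    rw [AddSubgroup.mem_addSubgroupOf]
    have h1 := hf ⟨q, hqR⟩
    dsimp only at h1
    rw [h1, add_sub_add_left_eq_sub, ← TensorProduct.tmul_sub, tmul_mem_twoPiILattice_iff h,
      sub_eq_neg_add] at hq
    exact hq

/-- The character `v ↦ exp (-2πi ⟨λ, v⟩)` of the finite group `h.quotient Γ`. -/
theorem IsBasis.exists_addChar (h : IsBasis Φ σ) {lam : StrongDual ℝ V}
    (hlam : lam ∈ dualLattice Γ) : ∃ ψ : AddChar (h.quotient Γ) ℂ,
      ∀ v : h.lattice.toAddSubgroup,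
        ψ (QuotientAddGroup.mk v) = exp (-(2 * (Real.pi : ℂ) * I * lam (v : V))) := by
  let φ : h.lattice.toAddSubgroup →+ Additive ℂ :=
    { toFun := fun v => Additive.ofMul (exp (-(2 * (Real.pi : ℂ) * I * lam (v : V))))
      map_zero' := by simp
      map_add' := fun v w => by
        rw [← ofMul_mul, ← exp_add]
        congr 2
        rw [AddSubgroup.coe_add, map_add, ofReal_add]
        ring }
  refine ⟨AddChar.toAddMonoidHomEquiv.symm (QuotientAddGroup.lift _ φ ?_), fun v => rfl⟩
  intro v hv
  rw [AddSubgroup.mem_addSubgroupOf] at hv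
  obtain ⟨m, hm⟩ := hlam v hv
  change Additive.ofMul (exp (-(2 * (Real.pi : ℂ) * I * lam (v : V)))) = Additive.ofMul 1
  rw [hm, ofReal_intCast, mul_comm, exp_neg, exp_int_mul_two_pi_mul_I, inv_one]

variable [DiscreteTopology Γ] [IsZLattice ℝ Γ]

theorem IsBasis.finite_quotient (h : IsBasis Φ σ) (hΦ : ∀ k, Φ k ∈ dualLattice Γ) :
    Finite (h.quotient Γ) :=
  have : (Γ.toAddSubgroup.addSubgroupOf h.lattice.toAddSubgroup).FiniteIndex :=
    ⟨h.relIndex_ne_zero hΦ⟩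
  AddSubgroup.finite_quotient_of_finiteIndex

theorem IsReducedSet.finite {R : Set (Complexified V)} (hR : IsReducedSet Γ Φ y σ R)
    (h : IsBasis Φ σ) (hΦ : ∀ k, Φ k ∈ dualLattice Γ) : R.Finite := by
  obtain ⟨p₀, hp₀⟩ := h.polePoints_nonempty y
  obtain ⟨f, -, hf⟩ := h.exists_bijective hR hp₀
  have := h.finite_quotient hΦ
  exact Set.finite_coe_iff.1 (Finite.of_injective _ hf.1)

/-- After factoring out the value at `p₀`, the sum is that of a character over `h.quotient Γ`: the
order of the group, which is the volume of `σ`, or zero. -/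
theorem IsBasis.exists_finsum_eq (h : IsBasis Φ σ) (hΦ : ∀ k, Φ k ∈ dualLattice Γ)
    {R : Set (Complexified V)} (hR : IsReducedSet Γ Φ y σ R) {lam : StrongDual ℝ V}
    (hlam : lam ∈ dualLattice Γ) {p₀ : Complexified V} (hp₀ : p₀ ∈ polePoints Φ y σ) :
    ((∀ j ∈ σ, ∃ m : ℤ, h.coord lam j = m) →
      ∑ᶠ p ∈ R, exp (-pair lam p) = basisVolume Γ Φ σ * exp (-pair lam p₀)) ∧
    ((¬ ∀ j ∈ σ, ∃ m : ℤ, h.coord lam j = m) → ∑ᶠ p ∈ R, exp (-pair lam p) = 0) := by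
  classical
  obtain ⟨f, hf, hbij⟩ := h.exists_bijective hR hp₀
  obtain ⟨ψ, hψ⟩ := h.exists_addChar hlam
  have := h.finite_quotient hΦ
  have := Fintype.ofFinite (h.quotient Γ)
  have hsum : ∑ᶠ p ∈ R, exp (-pair lam p) = exp (-pair lam p₀) * ∑ x, ψ x := by
    rw [← finsum_set_coe_eq_finsum_mem (f := fun p => exp (-pair lam p)), Finset.mul_sum,
      ← finsum_eq_sum_of_fintype]
    refine finsum_eq_of_bijective _ hbij fun p => ?_
    rw [hψ, ← exp_add, hf p, map_add, pair_tmul]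
    congr 1
    ring
  -- `AddChar` is written additively here, so `ψ = 0` is the trivial character. It is tested on the
  -- generators `h.predual j`, where `lam` takes its coordinates as values.
  have hiff : ψ = 0 ↔ ∀ j ∈ σ, ∃ m : ℤ, h.coord lam j = m := by
    constructor
    · intro h0 j hj
      have h1 := hψ ⟨h.predual ⟨j, hj⟩, h.predual_mem_lattice _⟩
      rw [h0, AddChar.zero_apply, h.apply_predual lam ⟨j, hj⟩, eq_comm, exp_eq_one_iff] at h1
      obtain ⟨n, hn⟩ := h1
      refine ⟨-n, ?_⟩
      have h2 : (2 * (Real.pi : ℂ) * I) * (h.coord lam j : ℂ) =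
          (2 * (Real.pi : ℂ) * I) * ((-n : ℤ) : ℂ) := by
        push_cast
        linear_combination -hn
      exact_mod_cast mul_left_cancel₀ two_pi_I_ne_zero h2
    · intro hint
      have hint' : ∀ v ∈ h.lattice, ∃ m : ℤ, lam v = m := by
        intro v hv
        refine Submodule.span_induction ?_ ⟨0, by simp⟩ ?_ ?_ hv
        · rintro _ ⟨j, rfl⟩
          rw [h.apply_predual]
          exact hint j j.2
        · rintro v w - - ⟨m, hm⟩ ⟨n, hn⟩
          exact ⟨m + n, by rw [map_add, hm, hn, Int.cast_add]⟩
        · rintro k v - ⟨m, hm⟩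
          exact ⟨k * m, by rw [map_zsmul, hm, zsmul_eq_mul, Int.cast_mul]⟩
      ext x
      obtain ⟨v, rfl⟩ := QuotientAddGroup.mk_surjective x
      obtain ⟨m, hm⟩ := hint' v v.2
      rw [hψ, hm, ofReal_intCast, mul_comm, exp_neg, exp_int_mul_two_pi_mul_I, inv_one,
        AddChar.zero_apply]
  rw [hsum, AddChar.sum_eq_ite]
  refine ⟨fun hint => ?_, fun hint => ?_⟩
  · rw [if_pos (hiff.2 hint), mul_comm, h.basisVolume_eq hΦ, ofReal_natCast,
      ← Nat.card_eq_fintype_card]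
    rfl
  · rw [if_neg fun h0 => hint (hiff.1 h0), mul_zero]

end Poles

end PartitionPolytope

namespace PartitionPolytope

/-! ### Genericity is an open dense condition -/

section Generic

open Complex

variable {V : Type*} [NormedAddCommGroup V] [NormedSpace ℝ V] [FiniteDimensional ℝ V]
  {Γ : Submodule ℤ V} [DiscreteTopology Γ] [IsZLattice ℝ Γ]
  {N : ℕ} {Φ : Fin N → StrongDual ℝ V} {σ : Finset (Fin N)}

/-- A common denominator `d` of the coordinates of `Φ k` in the basis `σ`, such that `1 / d` is,
modulo the integers, a value of `Φ k` on the lattice of `σ`. -/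
theorem IsBasis.exists_denominator (h : IsBasis Φ σ) (hΦ : ∀ k, Φ k ∈ dualLattice Γ)
    (k : Fin N) : ∃ (d : ℤ) (n : Fin N → ℤ), d ≠ 0 ∧ (d : ℝ) • Φ k = ∑ j ∈ σ, (n j : ℝ) • Φ j ∧
      ∃ v ∈ h.lattice, ∃ m : ℤ, (d : ℝ) * (Φ k v + m) = 1 := by
  obtain ⟨D, hD0, hD⟩ : ∃ D : ℕ, D ≠ 0 ∧ ∀ v ∈ h.lattice, ∃ z : ℤ, (D : ℝ) * Φ k v = z := by
    refine ⟨_, h.relIndex_ne_zero hΦ, fun v hv => ?_⟩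
    have hmem : Γ.toAddSubgroup.relIndex h.lattice.toAddSubgroup • v ∈ Γ :=
      (Γ.toAddSubgroup.addSubgroupOf h.lattice.toAddSubgroup).nsmul_index_mem ⟨v, hv⟩
    obtain ⟨z, hz⟩ := hΦ k _ hmem
    exact ⟨z, by rw [← hz, map_nsmul, nsmul_eq_mul]⟩
  have hDR : (D : ℝ) ≠ 0 := Nat.cast_ne_zero.2 hD0
  -- The values of `Φ k` on `h.lattice`, together with the integers, form a group; scaled by `D` it
  -- is a subgroup of ℤ with a generator `g`, and `d` is `D / g`.
  let B : AddSubgroup ℤ :=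
    { carrier := {z | ∃ v ∈ h.lattice, ∃ m : ℤ, (z : ℝ) = D * (Φ k v + m)}
      zero_mem' := ⟨0, zero_mem _, 0, by simp⟩
      add_mem' := by
        rintro a b ⟨v, hv, m, ha⟩ ⟨w, hw, l, hb⟩
        refine ⟨v + w, add_mem hv hw, m + l, ?_⟩
        rw [Int.cast_add, ha, hb, map_add, Int.cast_add]
        ring
      neg_mem' := by
        rintro a ⟨v, hv, m, ha⟩
        refine ⟨-v, neg_mem hv, -m, ?_⟩
        rw [Int.cast_neg, ha, map_neg, Int.cast_neg]
        ring }
  obtain ⟨g, hg⟩ := Int.subgroup_cyclic B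
  have hB : ∀ z : ℤ, z ∈ B → ∃ q : ℤ, z = q * g := fun z hz => by
    rw [hg, AddSubgroup.mem_closure_singleton] at hz
    obtain ⟨q, hq⟩ := hz
    exact ⟨q, by rw [← hq, smul_eq_mul]⟩
  obtain ⟨d, hd⟩ := hB D ⟨0, zero_mem _, 1, by simp⟩
  have hdR : (D : ℝ) = d * g := by exact_mod_cast hd
  have hg0 : (g : ℝ) ≠ 0 := fun h0 => hDR (by rw [hdR, h0, mul_zero])
  have hd0 : d ≠ 0 := by
    rintro rfl
    simp [hD0] at hdR
  have hn : ∀ j : Fin N, ∃ n : ℤ, ∀ hj : j ∈ σ, (d : ℝ) * h.coord (Φ k) j = n := by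
    intro j
    by_cases hj : j ∈ σ
    · obtain ⟨z, hz⟩ := hD _ (h.predual_mem_lattice ⟨j, hj⟩)
      obtain ⟨n, hn⟩ := hB z ⟨_, h.predual_mem_lattice ⟨j, hj⟩, 0, by rw [← hz]; simp⟩
      refine ⟨n, fun _ => mul_right_cancel₀ hg0 ?_⟩
      rw [h.apply_predual, hn, hdR] at hz
      push_cast at hz
      linear_combination hz
    · exact ⟨0, fun hj' => absurd hj' hj⟩
  choose n hn using hn
  refine ⟨d, n, hd0, ?_, ?_⟩
  · conv_lhs => rw [← h.sum_coord (Φ k), Finset.smul_sum]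
    exact Finset.sum_congr rfl fun j hj => by rw [smul_smul, hn j hj]
  · obtain ⟨v, hv, m, hm⟩ : g ∈ B := by
      rw [hg]
      exact AddSubgroup.mem_closure_singleton_self g
    refine ⟨v, hv, m, mul_right_cancel₀ hg0 ?_⟩
    rw [hdR] at hm
    linear_combination -hm

/-- As `p` varies over the poles, y_k + ⟨Φ_k, p⟩ modulo 2πi runs through a coset of (2πi/d)ℤ. Some
value is zero exactly when d times any of them is in 2πiℤ, a condition on `y` alone. It serves both
for density and, in the main induction, as the relation that `y` violates. -/
theorem IsBasis.exists_relation (h : IsBasis Φ σ) (hΦ : ∀ k, Φ k ∈ dualLattice Γ)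
    (k : Fin N) : ∃ (d : ℤ) (n : Fin N → ℤ), d ≠ 0 ∧ (d : ℝ) • Φ k = ∑ j ∈ σ, (n j : ℝ) • Φ j ∧
      ∀ y : Fin N → ℂ, (∃ p ∈ polePoints Φ y σ, exp (y k) * exp (pair (Φ k) p) = 1) ↔
        exp (d * y k - ∑ j ∈ σ, n j * y j) = 1 := by
  obtain ⟨d, n, hd0, hrel, v, hv, m, hvm⟩ := h.exists_denominator hΦ k
  refine ⟨d, n, hd0, hrel, fun y => ?_⟩
  have key : ∀ p ∈ polePoints Φ y σ, exp (d * y k - ∑ j ∈ σ, n j * y j) =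
      exp (d * (y k + pair (Φ k) p)) := by
    intro p hp
    have h1 := exp_neg_pair hp hrel
    rw [pair_smul_left, ofReal_intCast] at h1
    have h2 : ∑ j ∈ σ, n j * y j = ∑ j ∈ σ, y j * n j :=
      Finset.sum_congr rfl fun j _ => mul_comm _ _
    rw [h2, exp_sub, ← h1, ← exp_sub]
    congr 1
    ring
  constructor
  · rintro ⟨p, hp, hpk⟩
    rw [key p hp, exp_int_mul, exp_add, hpk, one_zpow]
  · intro hy
    obtain ⟨p₀, hp₀⟩ := h.polePoints_nonempty y
    rw [key p₀ hp₀, exp_eq_one_iff] at hy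
    obtain ⟨l, hl⟩ := hy
    -- At `p₀` the value is 2πi l/d; since `Φ k v` is 1/d - m, this shift leaves 2πi l m.
    refine ⟨p₀ + (2 * (Real.pi : ℂ) * I) ⊗ₜ[ℝ] (-l • v),
      h.add_mem_polePoints hp₀ (Submodule.smul_mem _ _ hv), ?_⟩
    rw [← exp_add, map_add, pair_tmul, exp_eq_one_iff]
    refine ⟨l * m, ?_⟩
    have hd : (d : ℂ) ≠ 0 := Int.cast_ne_zero.2 hd0
    have hvm' : (d : ℂ) * (Φ k v + m) = 1 := by exact_mod_cast hvm
    refine mul_left_cancel₀ hd ?_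
    rw [map_zsmul, zsmul_eq_mul]
    push_cast
    linear_combination hl - l * (2 * (Real.pi : ℂ) * I) * hvm'

/-- Only finitely many pairs (σ, k) occur, and each form is nonzero because its coefficient at `k ∉
σ` is d ≠ 0. Nonzero forms are open maps, so preimages of dense sets are dense. -/
theorem exists_isGeneric_eq_iInter (hΦ : ∀ k, Φ k ∈ dualLattice Γ) (c : Set (StrongDual ℝ V)) :
    ∃ L : Finset (Fin N) → Fin N → (Fin N → ℂ) →L[ℂ] ℂ,
      (∀ σ ∈ chamberBases Φ c, ∀ k ∉ σ, L σ k ≠ 0) ∧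
      {y | IsGeneric Φ c y} =
        ⋂ i ∈ {i : Finset (Fin N) × Fin N | i.1 ∈ chamberBases Φ c ∧ i.2 ∉ i.1},
          {y | exp (L i.1 i.2 y) ≠ 1} := by
  have hL : ∀ (σ : Finset (Fin N)) (k : Fin N), ∃ L : (Fin N → ℂ) →L[ℂ] ℂ,
      σ ∈ chamberBases Φ c → k ∉ σ → L ≠ 0 ∧
        ∀ y, (∃ p ∈ polePoints Φ y σ, exp (y k) * exp (pair (Φ k) p) = 1) ↔ exp (L y) = 1 := by
    intro σ k
    by_cases hσ : σ ∈ chamberBases Φ c ∧ k ∉ σ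
    · obtain ⟨d, n, hd0, -, hiff⟩ := (mem_chamberBases.1 hσ.1).1.exists_relation hΦ k
      refine ⟨(d : ℂ) • ContinuousLinearMap.proj (R := ℂ) (φ := fun _ => ℂ) k -
        ∑ j ∈ σ, (n j : ℂ) • ContinuousLinearMap.proj (R := ℂ) (φ := fun _ => ℂ) j,
        fun _ _ => ⟨fun h0 => ?_, fun y => ?_⟩⟩
      · have h1 := DFunLike.congr_fun h0 (Pi.single k 1)
        have h2 : ∀ j ∈ σ, (n j : ℂ) * (Pi.single k (1 : ℂ) : Fin N → ℂ) j = 0 := fun j hj => by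
          rw [Pi.single_eq_of_ne (ne_of_mem_of_not_mem hj hσ.2), mul_zero]
        simp [Finset.sum_eq_zero h2, hd0] at h1
      · rw [hiff y]
        simp
    · exact ⟨0, fun h1 h2 => absurd ⟨h1, h2⟩ hσ⟩
  choose L hL using hL
  refine ⟨L, fun σ hσ k hk => (hL σ k hσ hk).1, ?_⟩
  ext y
  simp only [mem_ofPred_eq, mem_iInter, Prod.forall]
  constructor
  · rintro hy σ k ⟨hσ, hk⟩ hexp
    obtain ⟨p, hp, hpk⟩ := ((hL σ k hσ hk).2 y).2 hexp
    exact hy σ hσ p hp k hk hpk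
  · intro hy σ hσ p hp k hk hpk
    exact hy σ k ⟨hσ, hk⟩ (((hL σ k hσ hk).2 y).1 ⟨p, hp, hpk⟩)

theorem isOpen_exp_ne_one : IsOpen {z : ℂ | exp z ≠ 1} :=
  isOpen_ne_fun continuous_exp continuous_const

theorem dense_exp_ne_one : Dense {z : ℂ | exp z ≠ 1} := by
  have : {z : ℂ | exp z ≠ 1} = (range fun n : ℤ => (n : ℂ) * (2 * Real.pi * I))ᶜ := by
    ext z
    simp [exp_eq_one_iff, eq_comm]
  rw [this]
  exact (countable_range _).dense_compl ℂ

theorem isOpen_isGeneric (hΦ : ∀ k, Φ k ∈ dualLattice Γ) (c : Set (StrongDual ℝ V)) :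
    IsOpen {y | IsGeneric Φ c y} := by
  obtain ⟨L, -, h⟩ := exists_isGeneric_eq_iInter hΦ c
  rw [h]
  exact (Set.toFinite _).isOpen_biInter fun i _ => isOpen_exp_ne_one.preimage (L i.1 i.2).continuous

theorem dense_isGeneric (hΦ : ∀ k, Φ k ∈ dualLattice Γ) (c : Set (StrongDual ℝ V)) :
    Dense {y | IsGeneric Φ c y} := by
  obtain ⟨L, hL, h⟩ := exists_isGeneric_eq_iInter hΦ c
  rw [h]
  refine dense_biInter_of_isOpen (fun i _ => isOpen_exp_ne_one.preimage (L i.1 i.2).continuous)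
    (Set.to_countable _) fun i hi => dense_exp_ne_one.preimage ?_
  refine (L i.1 i.2).isOpenMap_of_ne_zero (hL i.1 hi.1 i.2 hi.2)

end Generic

end PartitionPolytope

namespace PartitionPolytope

/-! ### The two restricted sums and their common recurrence -/

section Sums

open Complex

variable {V : Type*} [NormedAddCommGroup V] [NormedSpace ℝ V]
  {N : ℕ} {Φ : Fin N → StrongDual ℝ V}

/-- The image of the standard simplex is compact and avoids 0, hence a ball around 0; the general
case follows by scaling. -/
theorem exists_mul_sum_le_norm
    (hacute : ∀ x : Fin N → ℝ, (∀ k, 0 ≤ x k) → ∑ k, x k • Φ k = 0 → x = 0) :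
    ∃ δ : ℝ, 0 < δ ∧ ∀ x : Fin N → ℝ, (∀ k, 0 ≤ x k) → δ * ∑ k, x k ≤ ‖∑ k, x k • Φ k‖ := by
  have hK : IsCompact ((fun x : Fin N → ℝ => ∑ k, x k • Φ k) '' stdSimplex ℝ (Fin N)) :=
    (isCompact_stdSimplex ℝ (Fin N)).image (by fun_prop)
  have h0 : (0 : StrongDual ℝ V) ∉
      (fun x : Fin N → ℝ => ∑ k, x k • Φ k) '' stdSimplex ℝ (Fin N) := by
    rintro ⟨x, hx, hx0⟩
    have := hx.2
    rw [hacute x hx.1 hx0] at this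
    simp at this
  obtain ⟨δ, hδ, hball⟩ := Metric.isOpen_iff.1 hK.isClosed.isOpen_compl 0 h0
  refine ⟨δ, hδ, fun x hx => ?_⟩
  rcases (Finset.sum_nonneg fun k _ => hx k : 0 ≤ ∑ k, x k).eq_or_lt with hs | hs
  · rw [← hs, mul_zero]
    exact norm_nonneg _
  have hmem : (∑ k, x k)⁻¹ • ∑ k, x k • Φ k ∈
      (fun x : Fin N → ℝ => ∑ k, x k • Φ k) '' stdSimplex ℝ (Fin N) := by
    refine ⟨fun k => (∑ k, x k)⁻¹ * x k, ⟨fun k => mul_nonneg (inv_nonneg.2 hs.le) (hx k), ?_⟩, ?_⟩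
    · rw [← Finset.mul_sum, inv_mul_cancel₀ hs.ne']
    · simp only [Finset.smul_sum, mul_smul]
  by_contra! hlt
  refine hball ?_ hmem
  rw [mem_ball_zero_iff, norm_smul, norm_inv, Real.norm_of_nonneg hs.le, inv_mul_lt_iff₀ hs,
    mul_comm]
  exact hlt

theorem mem_latticePoints {ξ : Fin N → ℤ} {a : StrongDual ℝ V} :
    ξ ∈ latticePoints Φ a ↔ (∀ k, 0 ≤ ξ k) ∧ ∑ k, (ξ k : ℝ) • Φ k = a := by
  simp [latticePoints, partitionPolytope]

theorem finite_latticePoints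
    (hacute : ∀ x : Fin N → ℝ, (∀ k, 0 ≤ x k) → ∑ k, x k • Φ k = 0 → x = 0)
    (a : StrongDual ℝ V) : (latticePoints Φ a).Finite := by
  obtain ⟨δ, hδ, h⟩ := exists_mul_sum_le_norm hacute
  refine (Set.finite_Icc (0 : Fin N → ℤ) fun _ => ⌈‖a‖ / δ⌉).subset ?_
  intro ξ hξ
  obtain ⟨hξ, hξa⟩ := mem_latticePoints.1 hξ
  refine ⟨hξ, fun k => ?_⟩
  have hξ' : ∀ k, (0 : ℝ) ≤ ξ k := fun k => Int.cast_nonneg (hξ k)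
  have h1 := h _ hξ'
  rw [hξa, ← le_div_iff₀' hδ] at h1
  have h2 := Finset.single_le_sum (f := fun k => (ξ k : ℝ)) (fun j _ => hξ' j) (Finset.mem_univ k)
  exact_mod_cast (h2.trans h1).trans (Int.le_ceil _)

/-- The integral points of the partition polytope supported in `S`. -/
def subPoints (Φ : Fin N → StrongDual ℝ V) (S : Finset (Fin N)) (a : StrongDual ℝ V) :
    Set (Fin N → ℤ) :=
  {ξ | ξ ∈ latticePoints Φ a ∧ ∀ k ∉ S, ξ k = 0}

/-- The sum of the exponential over the integral points supported in `S`. -/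
noncomputable def subSum (Φ : Fin N → StrongDual ℝ V) (y : Fin N → ℂ) (S : Finset (Fin N))
    (a : StrongDual ℝ V) : ℂ :=
  ∑ᶠ ξ ∈ subPoints Φ S a, exp (∑ k, y k * (ξ k : ℂ))

theorem subSum_univ (y : Fin N → ℂ) (a : StrongDual ℝ V) :
    subSum Φ y Finset.univ a = expSum Φ y a := by
  simp [subSum, expSum, subPoints]

theorem subPoints_eq_union {S : Finset (Fin N)} {k : Fin N} (hk : k ∈ S) (a : StrongDual ℝ V) :
    subPoints Φ S a = subPoints Φ (S.erase k) a ∪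
      (fun ξ => ξ + Pi.single k 1) '' subPoints Φ S (a - Φ k) := by
  have hsum : ∀ ξ : Fin N → ℤ, ∑ j, (((ξ + Pi.single k 1 : Fin N → ℤ) j : ℤ) : ℝ) • Φ j =
      ∑ j, (ξ j : ℝ) • Φ j + Φ k := by
    intro ξ
    simp only [Pi.add_apply, Int.cast_add, add_smul, Finset.sum_add_distrib]
    congr 1
    rw [Finset.sum_eq_single k]
    · simp
    · intro j _ hj
      simp [Pi.single_eq_of_ne hj]
    · simp
  ext ξ
  constructor
  · rintro ⟨hξL, hξS⟩
    obtain ⟨hξ, hξa⟩ := mem_latticePoints.1 hξL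
    by_cases h0 : ξ k = 0
    · refine Or.inl ⟨hξL, fun j hj => ?_⟩
      by_cases hjk : j = k
      · rw [hjk, h0]
      · exact hξS j fun h => hj (Finset.mem_erase.2 ⟨hjk, h⟩)
    · have hξ' : ξ = (ξ - Pi.single k 1) + Pi.single k 1 := (sub_add_cancel _ _).symm
      refine Or.inr ⟨ξ - Pi.single k 1,
        ⟨mem_latticePoints.2 ⟨fun j => ?_, ?_⟩, fun j hj => ?_⟩, hξ'.symm⟩
      · have hj := hξ j
        by_cases hjk : j = k
        · subst hjk
          simp only [Pi.sub_apply, Pi.single_eq_same]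
          omega
        · simpa [Pi.single_eq_of_ne hjk] using hj
      · rw [eq_sub_iff_add_eq, ← hsum, ← hξ', hξa]
      · rw [Pi.sub_apply, hξS j hj, Pi.single_eq_of_ne (ne_of_mem_of_not_mem hk hj).symm, sub_zero]
  · rintro (⟨hξ, hξS⟩ | ⟨ξ, ⟨hξL, hξS⟩, rfl⟩)
    · exact ⟨hξ, fun j hj => hξS j fun h => hj (Finset.mem_of_mem_erase h)⟩
    · obtain ⟨hξ, hξa⟩ := mem_latticePoints.1 hξL
      refine ⟨mem_latticePoints.2 ⟨fun j => ?_, by rw [hsum, hξa, sub_add_cancel]⟩, fun j hj => ?_⟩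
      · have : 0 ≤ (Pi.single k 1 : Fin N → ℤ) j := by
          rw [Pi.single_apply]
          split_ifs <;> norm_num
        exact add_nonneg (hξ j) this
      · change ξ j + (Pi.single k 1 : Fin N → ℤ) j = 0
        rw [hξS j hj, Pi.single_eq_of_ne (ne_of_mem_of_not_mem hk hj).symm, add_zero]

/-- The points with ξ_k ≥ 1 are the unit translates of the points for `a - Φ k`, each contributing
an extra exp(y_k); only those with ξ_k = 0 survive. -/
theorem subSum_sub
    (hacute : ∀ x : Fin N → ℝ, (∀ k, 0 ≤ x k) → ∑ k, x k • Φ k = 0 → x = 0)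
    (y : Fin N → ℂ) {S : Finset (Fin N)} {k : Fin N} (hk : k ∈ S) (a : StrongDual ℝ V) :
    subSum Φ y S a - exp (y k) * subSum Φ y S (a - Φ k) = subSum Φ y (S.erase k) a := by
  have hfin : ∀ S a, (subPoints Φ S a).Finite := fun S a =>
    (finite_latticePoints hacute a).subset fun ξ hξ => hξ.1
  rw [subSum, subPoints_eq_union hk, finsum_mem_union ?_ (hfin _ _) ((hfin _ _).image _),
    finsum_mem_image (add_left_injective _).injOn, ← subSum, add_sub_assoc]
  · conv_rhs => rw [← add_zero (subSum Φ y (S.erase k) a)]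
    congr 1
    rw [subSum, mul_finsum_mem' _ _ (hfin _ _), sub_eq_zero]
    refine finsum_mem_congr rfl fun ξ _ => ?_
    rw [← exp_add]
    congr 1
    have : ∑ j, y j * (((Pi.single k 1 : Fin N → ℤ) j : ℤ) : ℂ) = y k := by
      rw [Finset.sum_eq_single k]
      · simp
      · intro j _ hj
        simp [Pi.single_eq_of_ne hj]
      · simp
    simp only [Pi.add_apply, Int.cast_add, mul_add, Finset.sum_add_distrib]
    rw [this, add_comm]
  · rw [Set.disjoint_left]
    rintro _ ⟨-, h0⟩ ⟨ξ, ⟨hξ, -⟩, rfl⟩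
    have h1 := h0 k (Finset.notMem_erase k S)
    have h2 := (mem_latticePoints.1 hξ).1 k
    simp only [Pi.add_apply, Pi.single_eq_same] at h1
    omega

/-- The partial zonotope of the `Φ i`, `i ∈ S`. -/
def subBox (Φ : Fin N → StrongDual ℝ V) (S : Finset (Fin N)) : Set (StrongDual ℝ V) :=
  {b | ∃ t : Fin N → ℝ, (∀ i, 0 ≤ t i) ∧ (∀ i, t i ≤ 1) ∧ b = ∑ i ∈ S, t i • Φ i}

theorem box_eq_subBox : box Φ = subBox Φ Finset.univ := by
  ext b
  rw [box, mem_parallelepiped_iff]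
  constructor
  · rintro ⟨t, ⟨h0, h1⟩, hb⟩
    exact ⟨t, h0, h1, hb⟩
  · rintro ⟨t, h0, h1, hb⟩
    exact ⟨t, ⟨h0, h1⟩, hb⟩

theorem sum_eq_sum_of_forall_notMem {ξ : Fin N → ℤ} {S : Finset (Fin N)} (h : ∀ k ∉ S, ξ k = 0) :
    ∑ k, (ξ k : ℝ) • Φ k = ∑ k ∈ S, (ξ k : ℝ) • Φ k := by
  refine (Finset.sum_subset (Finset.subset_univ S) fun k _ hk => ?_).symm
  rw [h k hk, Int.cast_zero, zero_smul]

/-- If a - ∑ t_i Φ_i = ∑ ξ_i Φ_i, then a = ∑ (ξ_i + t_i) Φ_i lies in the cone of `S`. -/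
theorem subPoints_eq_empty {c : Set (StrongDual ℝ V)} {S : Finset (Fin N)}
    (hS : ∀ a ∈ c, a ∉ cone Φ S) {lam : StrongDual ℝ V} (hlam : lam ∈ c - subBox Φ S) :
    subPoints Φ S lam = ∅ := by
  obtain ⟨a, ha, b, ⟨t, ht, -, rfl⟩, rfl⟩ := hlam
  refine Set.eq_empty_of_forall_notMem fun ξ hξ => hS a ha ?_
  obtain ⟨⟨hξ, hξa⟩, hξS⟩ := hξ
  refine ⟨fun k => ξ k + t k, fun k => add_nonneg (hξ k) (ht k), ?_⟩
  simp only [add_smul]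
  rw [Finset.sum_add_distrib, ← sum_eq_sum_of_forall_notMem hξS, hξa, sub_add_cancel]

/-- The explicit sum restricted to the bases contained in `S` and the factors with index in `S`. -/
noncomputable def subExplicit [FiniteDimensional ℝ V] (Γ : Submodule ℤ V)
    (Φ : Fin N → StrongDual ℝ V) (c : Set (StrongDual ℝ V)) (y : Fin N → ℂ) (R : Finset (Fin N) → Set (Complexified V))
    (S : Finset (Fin N)) (a : StrongDual ℝ V) : ℂ :=
  ∑ σ ∈ chamberBases Φ c with σ ⊆ S, ((basisVolume Γ Φ σ : ℝ) : ℂ)⁻¹ *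
    ∑ᶠ p ∈ R σ, exp (-pair a p) * ∏ k ∈ S \ σ, 1 / (1 - exp (y k) * exp (pair (Φ k) p))

variable [FiniteDimensional ℝ V] {Γ : Submodule ℤ V} {c : Set (StrongDual ℝ V)}
  {y : Fin N → ℂ} {R : Finset (Fin N) → Set (Complexified V)}

theorem subExplicit_univ (a : StrongDual ℝ V) :
    subExplicit Γ Φ c y R Finset.univ a = explicitSum Γ Φ c y R a := by
  simp [subExplicit, explicitSum, Finset.compl_eq_univ_sdiff]

/-- The difference multiplies each term by 1 - exp(y_k) exp⟨Φ_k, p⟩. For `k ∉ σ` this cancels the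
factor of index `k`; for `k ∈ σ` it is zero because `p` is a pole, leaving just the bases inside
`S.erase k`. -/
theorem subExplicit_sub (hy : IsGeneric Φ c y)
    (hR : ∀ σ ∈ chamberBases Φ c, R σ ⊆ polePoints Φ y σ)
    (hfin : ∀ σ ∈ chamberBases Φ c, (R σ).Finite) {S : Finset (Fin N)} {k : Fin N} (hk : k ∈ S)
    (a : StrongDual ℝ V) :
    subExplicit Γ Φ c y R S a - exp (y k) * subExplicit Γ Φ c y R S (a - Φ k) =
      subExplicit Γ Φ c y R (S.erase k) a := by
  have hfilter : (chamberBases Φ c).filter (· ⊆ S.erase k) =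
      ((chamberBases Φ c).filter (· ⊆ S)).filter (k ∉ ·) := by
    ext σ
    simp only [Finset.mem_filter, Finset.subset_erase, and_assoc]
  rw [subExplicit, subExplicit, subExplicit, hfilter, Finset.sum_filter (k ∉ ·), Finset.mul_sum,
    ← Finset.sum_sub_distrib]
  refine Finset.sum_congr rfl fun σ hσ => ?_
  obtain ⟨hσB, hσS⟩ := Finset.mem_filter.1 hσ
  rw [finsum_mem_eq_finite_toFinset_sum _ (hfin σ hσB),
    finsum_mem_eq_finite_toFinset_sum _ (hfin σ hσB),
    finsum_mem_eq_finite_toFinset_sum _ (hfin σ hσB), mul_left_comm, ← mul_sub, Finset.mul_sum,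
    ← Finset.sum_sub_distrib]
  have hstep : ∀ p, exp (-pair a p) * ∏ j ∈ S \ σ, 1 / (1 - exp (y j) * exp (pair (Φ j) p)) -
      exp (y k) * (exp (-pair (a - Φ k) p) *
        ∏ j ∈ S \ σ, 1 / (1 - exp (y j) * exp (pair (Φ j) p))) =
      exp (-pair a p) * ((1 - exp (y k) * exp (pair (Φ k) p)) *
        ∏ j ∈ S \ σ, 1 / (1 - exp (y j) * exp (pair (Φ j) p))) := by
    intro p
    rw [pair_sub_left, neg_sub, sub_eq_add_neg (pair (Φ k) p), exp_add]
    ring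
  by_cases hkσ : k ∉ σ
  · rw [if_pos hkσ]
    congr 1
    refine Finset.sum_congr rfl fun p hp => ?_
    have hpR := hR σ hσB ((hfin σ hσB).mem_toFinset.1 hp)
    have hne : 1 - exp (y k) * exp (pair (Φ k) p) ≠ 0 :=
      sub_ne_zero.2 (hy σ hσB p hpR k hkσ).symm
    rw [hstep, ← Finset.mul_prod_erase _ _ (Finset.mem_sdiff.2 ⟨hk, hkσ⟩), ← mul_assoc _ (1 / _),
      mul_one_div_cancel hne, one_mul, Finset.erase_sdiff_comm]
  · rw [if_neg hkσ, Finset.sum_eq_zero, mul_zero]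
    intro p hp
    have hpR := hR σ hσB ((hfin σ hσB).mem_toFinset.1 hp)
    rw [hstep, hpR k (not_not.1 hkσ), ← exp_add, add_neg_cancel, exp_zero, sub_self, zero_mul,
      mul_zero]

end Sums

end PartitionPolytope

namespace PartitionPolytope

/-! ### Vanishing of solutions of the homogeneous recurrence -/

section Walk

open Complex

variable {V : Type*} [NormedAddCommGroup V] [NormedSpace ℝ V]
  {Γ : Submodule ℤ V} {N : ℕ} {Φ : Fin N → StrongDual ℝ V}
  {c : Set (StrongDual ℝ V)} {y : Fin N → ℂ} {S : Finset (Fin N)} {D : StrongDual ℝ V → ℂ}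

theorem sum_natCast_smul_mem_dualLattice (hΦ : ∀ k, Φ k ∈ dualLattice Γ) (n : Fin N → ℕ)
    (S : Finset (Fin N)) : ∑ i ∈ S, (n i : ℝ) • Φ i ∈ dualLattice Γ := by
  refine Submodule.sum_mem _ fun i _ => ?_
  rw [Nat.cast_smul_eq_nsmul]
  exact (dualLattice Γ).toAddSubgroup.nsmul_mem (hΦ i) (n i)

/-- If some `t i + v i` is at least `1`, there is a first moment at which some `t k + s * v k`
reaches `1`. -/
theorem exists_first_hit {t v : Fin N → ℝ} (ht1 : ∀ i, t i ≤ 1)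
    (hv : ∀ i, 0 ≤ v i) (hex : ∃ i ∈ S, 1 ≤ t i + v i) :
    ∃ k ∈ S, 1 ≤ t k + v k ∧ ∃ s : ℝ, 0 ≤ s ∧ s ≤ 1 ∧ t k + s * v k = 1 ∧
      ∀ i ∈ S, t i + s * v i ≤ 1 := by
  -- When `v i = 0` the filter forces `t i = 1`, and the quotient 0/0 = 0 is the correct hitting
  -- time.
  obtain ⟨k, hk, hmin⟩ := Finset.exists_min_image (S.filter fun i => 1 ≤ t i + v i)
    (fun i => (1 - t i) / v i) (by
      obtain ⟨i, hi, h⟩ := hex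
      exact ⟨i, Finset.mem_filter.2 ⟨hi, h⟩⟩)
  obtain ⟨hkS, hk1⟩ := Finset.mem_filter.1 hk
  have hs0 : 0 ≤ (1 - t k) / v k := div_nonneg (sub_nonneg.2 (ht1 k)) (hv k)
  have hs1 : (1 - t k) / v k ≤ 1 := div_le_one_of_le₀ (by linarith) (hv k)
  refine ⟨k, hkS, hk1, _, hs0, hs1, ?_, fun i hi => ?_⟩
  · rcases (hv k).eq_or_lt with h0 | h0
    · rw [← h0] at hk1 ⊢
      linarith [ht1 k]
    · rw [div_mul_cancel₀ _ h0.ne']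
      ring
  · by_cases hi1 : 1 ≤ t i + v i
    · rcases (hv i).eq_or_lt with h0 | h0
      · rw [← h0, mul_zero, add_zero]
        exact ht1 i
      · have := hmin i (Finset.mem_filter.2 ⟨hi, hi1⟩)
        rw [le_div_iff₀ h0] at this
        linarith
    · have := mul_le_mul_of_nonneg_right hs1 (hv i)
      linarith

/-- A function that satisfies the recurrence along each `Φ j` is quasi-periodic along lattice paths
that follow a straight path in `c` up to an error in the zonotope. -/
theorem eq_exp_mul_of_path (hΦ : ∀ k, Φ k ∈ dualLattice Γ)
    (hD : ∀ j ∈ S, ∀ μ ∈ dualLattice Γ, μ ∈ c - subBox Φ (S.erase j) →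
      D μ = exp (y j) * D (μ - Φ j))
    {a : StrongDual ℝ V} {t v : Fin N → ℝ} (ht0 : ∀ i, 0 ≤ t i) (ht1 : ∀ i, t i ≤ 1)
    (hv : ∀ i, 0 ≤ v i) (hpath : ∀ s : ℝ, 0 ≤ s → s ≤ 1 → a + s • ∑ i ∈ S, v i • Φ i ∈ c)
    (hmem : a - ∑ i ∈ S, t i • Φ i ∈ dualLattice Γ) :
    D (a - ∑ i ∈ S, t i • Φ i + ∑ i ∈ S, (⌊t i + v i⌋₊ : ℝ) • Φ i) =
      exp (∑ i ∈ S, y i * ⌊t i + v i⌋₊) * D (a - ∑ i ∈ S, t i • Φ i) := by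
  induction hM : ∑ i ∈ S, ⌊t i + v i⌋₊ generalizing a t v with
  | zero =>
    rw [Finset.sum_eq_zero_iff] at hM
    rw [Finset.sum_eq_zero (f := fun i => (⌊t i + v i⌋₊ : ℝ) • Φ i) fun i hi => by
        rw [hM i hi, Nat.cast_zero, zero_smul],
      Finset.sum_eq_zero (f := fun i => y i * (⌊t i + v i⌋₊ : ℂ)) fun i hi => by
        rw [hM i hi, Nat.cast_zero, mul_zero], add_zero, exp_zero, one_mul]
  | succ M ih =>
    obtain ⟨k, hk, hk1, s, hs0, hs1, hsk, hsle⟩ := exists_first_hit (S := S) ht1 hv (by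
      by_contra! hcon
      rw [Finset.sum_eq_zero fun i hi => Nat.floor_eq_zero.2 (hcon i hi)] at hM
      exact absurd hM (by omega))
    -- While the real point moves in `c` the lattice point stands still, so the offsets grow. When
    -- the one at `k` reaches 1 it is reset to 0 and the lattice point jumps by `Φ k`.
    obtain ⟨t', ht'⟩ : ∃ t' : Fin N → ℝ, t' = fun i => if i ∈ S.erase k then t i + s * v i else 0 :=
      ⟨_, rfl⟩
    have ht'k : t' k = 0 := by simp [ht']
    have ht'i : ∀ i ∈ S.erase k, t' i = t i + s * v i := fun i hi => by rw [ht']; exact if_pos hi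
    have ht'0 : ∀ i, 0 ≤ t' i := fun i => by
      rw [ht']
      dsimp only
      split_ifs
      exacts [add_nonneg (ht0 i) (mul_nonneg hs0 (hv i)), le_rfl]
    have ht'1 : ∀ i, t' i ≤ 1 := fun i => by
      by_cases hi : i ∈ S.erase k
      · rw [ht'i i hi]
        exact hsle i (Finset.mem_of_mem_erase hi)
      · rw [ht']
        exact (if_neg hi).trans_le zero_le_one
    have hsum' : ∑ i ∈ S, t' i • Φ i = ∑ i ∈ S.erase k, t' i • Φ i := by
      rw [← Finset.add_sum_erase _ _ hk, ht'k, zero_smul, zero_add]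
    have hnew : (a + s • ∑ i ∈ S, v i • Φ i) - ∑ i ∈ S, t' i • Φ i =
        (a - ∑ i ∈ S, t i • Φ i) + Φ k := by
      have h1 : ∑ i ∈ S.erase k, t' i • Φ i =
          ∑ i ∈ S.erase k, t i • Φ i + s • ∑ i ∈ S.erase k, v i • Φ i := by
        rw [Finset.smul_sum, ← Finset.sum_add_distrib]
        refine Finset.sum_congr rfl fun i hi => ?_
        rw [ht'i i hi]
        module
      have h2 : t k • Φ k + s • v k • Φ k = Φ k := by
        conv_rhs => rw [← one_smul ℝ (Φ k), ← hsk]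
        module
      rw [hsum', h1, ← Finset.add_sum_erase S (fun i => t i • Φ i) hk,
        ← Finset.add_sum_erase S (fun i => v i • Φ i) hk, smul_add]
      rw [← sub_eq_zero] at h2 ⊢
      refine Eq.trans ?_ h2
      module
    have hfloor : ∀ i ∈ S.erase k, ⌊t' i + (1 - s) * v i⌋₊ = ⌊t i + v i⌋₊ := fun i hi => by
      rw [ht'i i hi]
      congr 1
      ring
    have hfloork : ⌊t k + v k⌋₊ = ⌊t' k + (1 - s) * v k⌋₊ + 1 := by
      rw [ht'k, ← Nat.floor_add_one (by
        rw [zero_add]; exact mul_nonneg (sub_nonneg.2 hs1) (hv k))]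
      congr 1
      linear_combination hsk
    have hih := ih (a := a + s • ∑ i ∈ S, v i • Φ i) (t := t') (v := fun i => (1 - s) * v i)
      ht'0 ht'1 (fun i => mul_nonneg (sub_nonneg.2 hs1) (hv i)) (fun r hr0 hr1 => by
        have := hpath (s + r * (1 - s)) (by nlinarith [mul_nonneg hr0 (sub_nonneg.2 hs1)])
          (by nlinarith [mul_le_mul_of_nonneg_right hr1 (sub_nonneg.2 hs1)])
        convert this using 1
        simp only [mul_smul, ← Finset.smul_sum]
        module)
      (by rw [hnew]; exact add_mem hmem (hΦ k))
      (by
        rw [← Finset.add_sum_erase _ _ hk, hfloork, ← Finset.sum_congr rfl hfloor] at hM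
        rw [← Finset.add_sum_erase _ _ hk]
        omega)
    -- After the jump the offset at `k` is 0, so the new point differs from `c` only by the zonotope
    -- of `S.erase k`, as the recurrence requires.
    have hstep := hD k hk (a - ∑ i ∈ S, t i • Φ i + Φ k) (add_mem hmem (hΦ k)) (by
      rw [← hnew, hsum']
      exact ⟨_, hpath s hs0 hs1, _, ⟨t', ht'0, ht'1, rfl⟩, rfl⟩)
    rw [add_sub_cancel_right] at hstep
    rw [hnew, hstep, ← mul_assoc, ← exp_add] at hih
    have h1 : ∑ i ∈ S, (⌊t i + v i⌋₊ : ℝ) • Φ i =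
        Φ k + ∑ i ∈ S, (⌊t' i + (1 - s) * v i⌋₊ : ℝ) • Φ i := by
      rw [← Finset.add_sum_erase _ _ hk, ← Finset.add_sum_erase S _ hk, hfloork, Nat.cast_add,
        Nat.cast_one, ← add_assoc]
      congr 1
      · module
      · exact Finset.sum_congr rfl fun i hi => by rw [hfloor i hi]
    have h2 : ∑ i ∈ S, y i * (⌊t i + v i⌋₊ : ℂ) =
        ∑ i ∈ S, y i * (⌊t' i + (1 - s) * v i⌋₊ : ℂ) + y k := by
      rw [← Finset.add_sum_erase _ _ hk, ← Finset.add_sum_erase S _ hk, hfloork,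
        Finset.sum_congr rfl fun i hi => by rw [← hfloor i hi]]
      push_cast
      ring
    rw [h1, h2, ← add_assoc, hih]

/-- Deep inside `c`, a solution of the recurrences vanishes as soon as there is an integral relation
between the `Φ i` that is incompatible with quasi-periodicity. -/
theorem eq_zero_of_forall_add_mem (hΦ : ∀ k, Φ k ∈ dualLattice Γ)
    (hD : ∀ j ∈ S, ∀ μ ∈ dualLattice Γ, μ ∈ c - subBox Φ (S.erase j) →
      D μ = exp (y j) * D (μ - Φ j))
    {e : Fin N → ℤ} (he : ∑ i ∈ S, (e i : ℝ) • Φ i = 0) (hey : exp (∑ i ∈ S, y i * e i) ≠ 1)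
    {μ : StrongDual ℝ V} (hμ : μ ∈ dualLattice Γ)
    (hdeep : ∀ w : StrongDual ℝ V, ‖w‖ ≤ ∑ i ∈ S, |(e i : ℝ)| * ‖Φ i‖ → μ + w ∈ c) :
    D μ = 0 := by
  have hwalk : ∀ m : Fin N → ℕ, (∀ i, (m i : ℝ) ≤ |(e i : ℝ)|) →
      D (μ + ∑ i ∈ S, (m i : ℝ) • Φ i) = exp (∑ i ∈ S, y i * m i) * D μ := by
    intro m hm
    have := eq_exp_mul_of_path hΦ hD (a := μ) (t := 0) (v := fun i => (m i : ℝ))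
      (fun i => le_rfl) (fun i => zero_le_one) (fun i => Nat.cast_nonneg _) (fun s hs0 hs1 => by
        refine hdeep _ ?_
        rw [norm_smul, Real.norm_of_nonneg hs0]
        refine (mul_le_of_le_one_left (norm_nonneg _) hs1).trans ((norm_sum_le _ _).trans ?_)
        refine Finset.sum_le_sum fun i _ => ?_
        rw [norm_smul, Real.norm_of_nonneg (Nat.cast_nonneg _)]
        exact mul_le_mul_of_nonneg_right (hm i) (norm_nonneg _)) (by simpa using hμ)
    simpa using this
  have hcast : ∀ i, ((e i).toNat : ℤ) - ((-e i).toNat : ℤ) = e i := fun i =>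
    Int.toNat_sub_toNat_neg (e i)
  have hle : ∀ z : ℤ, ((z.toNat : ℕ) : ℝ) ≤ |(z : ℝ)| := fun z => by
    have : ((z.toNat : ℕ) : ℤ) ≤ |z| := by
      rw [Int.toNat_eq_max]
      exact max_le (le_abs_self z) (abs_nonneg z)
    exact_mod_cast this
  -- The positive and negative parts of `e` give two walks from `μ` with the same endpoint, whose
  -- factors have ratio exp(∑ y_i e_i) ≠ 1.
  have h1 := hwalk (fun i => (e i).toNat) fun i => hle _
  have h2 := hwalk (fun i => (-e i).toNat) fun i => (hle _).trans (by
    rw [Int.cast_neg, abs_neg])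
  have hsum : ∑ i ∈ S, ((e i).toNat : ℝ) • Φ i = ∑ i ∈ S, ((-e i).toNat : ℝ) • Φ i := by
    rw [← sub_eq_zero, ← Finset.sum_sub_distrib, ← he]
    refine Finset.sum_congr rfl fun i _ => ?_
    have : ((e i).toNat : ℝ) - ((-e i).toNat : ℝ) = e i := by exact_mod_cast hcast i
    rw [← this]
    module
  rw [hsum, h2] at h1
  by_contra hne
  have h3 := mul_right_cancel₀ hne h1
  refine hey ?_
  have h4 : ∑ i ∈ S, y i * (e i : ℂ) =
      ∑ i ∈ S, y i * ((e i).toNat : ℂ) - ∑ i ∈ S, y i * ((-e i).toNat : ℂ) := by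
    rw [← Finset.sum_sub_distrib]
    refine Finset.sum_congr rfl fun i _ => ?_
    have : ((e i).toNat : ℂ) - ((-e i).toNat : ℂ) = e i := by exact_mod_cast hcast i
    rw [← this]
    ring
  rw [h4, exp_sub, ← h3, div_self (exp_ne_zero _)]

/-- Following the ray through `a` far enough reaches a lattice point deep in `c`, where D vanishes;
quasi-periodicity carries the zero back. -/
theorem eq_zero_of_recurrence (hopen : IsOpen c) (hscale : ∀ a ∈ c, ∀ r : ℝ, 0 < r → r • a ∈ c)
    (hcone : c ⊆ cone Φ S) (hΦ : ∀ k, Φ k ∈ dualLattice Γ)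
    (hD : ∀ j ∈ S, ∀ μ ∈ dualLattice Γ, μ ∈ c - subBox Φ (S.erase j) →
      D μ = exp (y j) * D (μ - Φ j))
    {e : Fin N → ℤ} (he : ∑ i ∈ S, (e i : ℝ) • Φ i = 0) (hey : exp (∑ i ∈ S, y i * e i) ≠ 1)
    {lam : StrongDual ℝ V} (hlam : lam ∈ dualLattice Γ) (hmem : lam ∈ c - subBox Φ S) :
    D lam = 0 := by
  obtain ⟨a, ha, _, ⟨t, ht0, ht1, rfl⟩, rfl⟩ := hmem
  dsimp only at hlam ⊢
  obtain ⟨x, hx, hax⟩ := hcone ha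
  obtain ⟨ε, hε, hball⟩ := Metric.isOpen_iff.1 hopen a ha
  set r : ℝ := ∑ i ∈ S, |(e i : ℝ)| * ‖Φ i‖ with hr
  set r₀ : ℝ := ∑ i ∈ S, ‖Φ i‖ with hr₀
  have hr0 : 0 ≤ r := Finset.sum_nonneg fun i _ => mul_nonneg (abs_nonneg _) (norm_nonneg _)
  have hr₀0 : 0 ≤ r₀ := Finset.sum_nonneg fun i _ => norm_nonneg _
  -- The ball of radius (1 + s)ε about (1 + s)a lies in `c`. It must absorb both the rounding error,
  -- at most `r₀`, and the perturbation `w`, at most `r`.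
  set s : ℝ := (r + r₀) / ε with hs
  have hs0 : 0 ≤ s := div_nonneg (add_nonneg hr0 hr₀0) hε.le
  have hsa : ∑ i ∈ S, (s * x i) • Φ i = s • a := by
    rw [hax, Finset.smul_sum]
    exact Finset.sum_congr rfl fun i _ => mul_smul _ _ _
  have hwalk := eq_exp_mul_of_path hΦ hD (v := fun i => s * x i) ht0 ht1
    (fun i => mul_nonneg hs0 (hx i)) (fun u hu0 hu1 => by
      rw [hsa, smul_smul]
      nth_rw 1 [← one_smul ℝ a]
      rw [← add_smul]
      exact hscale a ha _ (add_pos_of_pos_of_nonneg one_pos (mul_nonneg hu0 hs0))) hlam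
  have hzero := eq_zero_of_forall_add_mem hΦ hD he hey
    (add_mem hlam (sum_natCast_smul_mem_dualLattice hΦ (fun i => ⌊t i + s * x i⌋₊) S))
    (fun w hw => by
      have h1s : 0 < 1 + s := add_pos_of_pos_of_nonneg one_pos hs0
      have heq : a - ∑ i ∈ S, t i • Φ i + ∑ i ∈ S, (⌊t i + s * x i⌋₊ : ℝ) • Φ i + w =
          (1 + s) • (a + (1 + s)⁻¹ • (w - ∑ i ∈ S, (t i + s * x i - ⌊t i + s * x i⌋₊) • Φ i)) := by
        rw [smul_add, smul_smul, mul_inv_cancel₀ h1s.ne', one_smul, add_smul, one_smul]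
        have hexp : ∑ i ∈ S, (t i + s * x i - ⌊t i + s * x i⌋₊) • Φ i =
            ∑ i ∈ S, t i • Φ i + s • a - ∑ i ∈ S, (⌊t i + s * x i⌋₊ : ℝ) • Φ i := by
          rw [← hsa, ← Finset.sum_add_distrib, ← Finset.sum_sub_distrib]
          exact Finset.sum_congr rfl fun i _ => by module
        rw [hexp]
        abel
      rw [heq]
      refine hscale _ (hball ?_) _ h1s
      rw [mem_ball_iff_norm, add_sub_cancel_left, norm_smul, norm_inv, Real.norm_of_nonneg h1s.le,
        inv_mul_lt_iff₀ h1s]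
      have hfract : ‖∑ i ∈ S, (t i + s * x i - ⌊t i + s * x i⌋₊) • Φ i‖ ≤ r₀ := by
        refine (norm_sum_le _ _).trans (Finset.sum_le_sum fun i _ => ?_)
        have hnn : 0 ≤ t i + s * x i := add_nonneg (ht0 i) (mul_nonneg hs0 (hx i))
        rw [norm_smul]
        refine mul_le_of_le_one_left (norm_nonneg _) ?_
        rw [Real.norm_of_nonneg (sub_nonneg.2 (Nat.floor_le hnn))]
        linarith [Nat.lt_floor_add_one (t i + s * x i)]
      have hsε : s * ε = r + r₀ := div_mul_cancel₀ _ hε.ne'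
      calc _ ≤ ‖w‖ + ‖∑ i ∈ S, (t i + s * x i - ⌊t i + s * x i⌋₊) • Φ i‖ := norm_sub_le _ _
        _ ≤ r + r₀ := add_le_add hw hfract
        _ < (1 + s) * ε := by rw [add_mul, hsε, one_mul]; linarith)
  rw [hzero, eq_comm, mul_eq_zero] at hwalk
  exact hwalk.resolve_left (exp_ne_zero _)

end Walk

/-! ### The induction on the set of indices -/

section Main

open Complex

variable {V : Type*} [NormedAddCommGroup V] [NormedSpace ℝ V] [FiniteDimensional ℝ V]
  {Γ : Submodule ℤ V} {N : ℕ} {Φ : Fin N → StrongDual ℝ V}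
  {c : Set (StrongDual ℝ V)} {y : Fin N → ℂ} {R : Finset (Fin N) → Set (Complexified V)}

theorem subExplicit_self {σ : Finset (Fin N)} (hσ : σ ∈ chamberBases Φ c) (a : StrongDual ℝ V) :
    subExplicit Γ Φ c y R σ a =
      ((basisVolume Γ Φ σ : ℝ) : ℂ)⁻¹ * ∑ᶠ p ∈ R σ, exp (-pair a p) := by
  have : (chamberBases Φ c).filter (· ⊆ σ) = {σ} := by
    ext τ
    rw [Finset.mem_filter, Finset.mem_singleton]
    constructor
    · rintro ⟨hτ, hsub⟩
      refine Finset.eq_of_subset_of_card_le hsub ?_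
      rw [(mem_chamberBases.1 hτ).1.1, (mem_chamberBases.1 hσ).1.1]
    · rintro rfl
      exact ⟨hσ, subset_rfl⟩
  rw [subExplicit, this, Finset.sum_singleton]
  simp

variable [DiscreteTopology Γ] [IsZLattice ℝ Γ]

/-- If the coordinates of `lam` are integers, they are the only point and the character sum cancels
the volume; otherwise there is no point and the character sum is zero. -/
theorem subSum_eq_subExplicit_self (hΦ : ∀ k, Φ k ∈ dualLattice Γ) (hc : IsChamber Φ c)
    {σ : Finset (Fin N)} (hσ : σ ∈ chamberBases Φ c) (hR : IsReducedSet Γ Φ y σ (R σ))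
    {lam : StrongDual ℝ V} (hlam : lam ∈ dualLattice Γ) (hmem : lam ∈ c - subBox Φ σ) :
    subSum Φ y σ lam = subExplicit Γ Φ c y R σ lam := by
  obtain ⟨hb, hcσ⟩ := mem_chamberBases.1 hσ
  obtain ⟨p₀, hp₀⟩ := hb.polePoints_nonempty y
  obtain ⟨hint, hnot⟩ := hb.exists_finsum_eq hΦ hR hlam hp₀
  have huniq : ∀ ξ ∈ subPoints Φ σ lam, ∀ j ∈ σ, hb.coord lam j = ξ j := by
    rintro ξ ⟨hξ, hξσ⟩ j hj
    rw [← (mem_latticePoints.1 hξ).2, sum_eq_sum_of_forall_notMem hξσ,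
      hb.coord_sum (fun j => (ξ j : ℝ)) hj]
  rw [subExplicit_self hσ, subSum]
  by_cases hZ : ∀ j ∈ σ, ∃ m : ℤ, hb.coord lam j = m
  · have hm : ∀ j, ∃ m : ℤ, (j ∈ σ → hb.coord lam j = m) ∧ (j ∉ σ → m = 0) := fun j => by
      by_cases hj : j ∈ σ
      · obtain ⟨m, hm⟩ := hZ j hj
        exact ⟨m, fun _ => hm, fun h => absurd hj h⟩
      · exact ⟨0, fun h => absurd h hj, fun _ => rfl⟩
    choose m hm hm0 using hm
    have hlam_eq : lam = ∑ j ∈ σ, (m j : ℝ) • Φ j := by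
      conv_lhs => rw [← hb.sum_coord lam]
      exact Finset.sum_congr rfl fun j hj => by rw [hm j hj]
    have hpts : subPoints Φ σ lam = {m} := by
      ext ξ
      rw [mem_singleton_iff]
      constructor
      · intro hξ
        funext j
        by_cases hj : j ∈ σ
        · have := huniq ξ hξ j hj
          rw [hm j hj] at this
          exact_mod_cast this.symm
        · rw [hξ.2 j hj, hm0 j hj]
      · rintro rfl
        refine ⟨mem_latticePoints.2 ⟨fun j => ?_, ?_⟩, fun j hj => hm0 j hj⟩
        · by_cases hj : j ∈ σ
          · obtain ⟨a, ha, _, ⟨t, -, ht1, rfl⟩, heq⟩ := hmem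
            have hpos := hb.coord_pos (hcσ ha) (hc.notMem_singularSet ha) hj
            have h1 := hm j hj
            rw [← heq] at h1
            dsimp only at h1
            rw [map_sub, Pi.sub_apply, hb.coord_sum t hj] at h1
            -- A positive coordinate minus at most 1 exceeds -1, so an integer one is nonnegative:
            -- this is why the zonotope may be subtracted from `c`.
            have h2 : (-1 : ℝ) < ξ j := by linarith [ht1 j]
            have h3 : (-1 : ℤ) < ξ j := by exact_mod_cast h2
            omega
          · rw [hm0 j hj]
        · rw [sum_eq_sum_of_forall_notMem hm0, ← hlam_eq]
    have hvol : ((basisVolume Γ Φ σ : ℝ) : ℂ) ≠ 0 := by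
      rw [hb.basisVolume_eq hΦ]
      exact_mod_cast hb.relIndex_ne_zero hΦ
    rw [hpts, finsum_mem_singleton, hint hZ, inv_mul_cancel_left₀ hvol, exp_neg_pair hp₀ hlam_eq]
    congr 1
    refine (Finset.sum_subset (Finset.subset_univ σ) fun j _ hj => ?_).symm
    rw [hm0 j hj, Int.cast_zero, mul_zero]
  · have hpts : subPoints Φ σ lam = ∅ :=
      Set.eq_empty_of_forall_notMem fun ξ hξ => hZ fun j hj => ⟨ξ j, huniq ξ hξ j hj⟩
    rw [hpts, finsum_mem_empty, hnot hZ, mul_zero]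

theorem sum_eq_add_sum_of_insert_subset {M : Type*} [AddCommMonoid M] {S σ : Finset (Fin N)}
    {k : Fin N} (hkσ : k ∉ σ) (hkS : k ∈ S) (hσS : σ ⊆ S) {f : Fin N → M}
    (hf : ∀ i ∉ insert k σ, f i = 0) : ∑ i ∈ S, f i = f k + ∑ i ∈ σ, f i := by
  rw [← Finset.sum_insert hkσ]
  exact (Finset.sum_subset (Finset.insert_subset hkS hσS) fun i _ hi => hf i hi).symm

theorem subSum_eq_subExplicit
    (hacute : ∀ x : Fin N → ℝ, (∀ k, 0 ≤ x k) → ∑ k, x k • Φ k = 0 → x = 0)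
    (hΦ : ∀ k, Φ k ∈ dualLattice Γ) (hc : IsChamber Φ c) (hy : IsGeneric Φ c y)
    (hR : ∀ σ ∈ chamberBases Φ c, IsReducedSet Γ Φ y σ (R σ)) (S : Finset (Fin N))
    {lam : StrongDual ℝ V} (hlam : lam ∈ dualLattice Γ) (hmem : lam ∈ c - subBox Φ S) :
    subSum Φ y S lam = subExplicit Γ Φ c y R S lam := by
  induction S using Finset.strongInduction generalizing lam with
  | H S ih =>
  by_cases hS : ∃ a ∈ c, a ∈ cone Φ S
  · obtain ⟨a, ha, haS⟩ := hS
    obtain ⟨σ, hσS, hσ⟩ := hc.exists_mem_chamberBases ha haS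
    obtain ⟨hb, hcσ⟩ := mem_chamberBases.1 hσ
    rcases hσS.eq_or_ssubset with rfl | hss
    · exact subSum_eq_subExplicit_self hΦ hc hσ (hR _ hσ) hlam hmem
    obtain ⟨k, hkS, hkσ⟩ := Finset.exists_of_ssubset hss
    obtain ⟨d, n, -, hrel, hiff⟩ := hb.exists_relation hΦ k
    have hne : exp (d * y k - ∑ j ∈ σ, n j * y j) ≠ 1 := fun h1 => by
      obtain ⟨p, hp, hpk⟩ := (hiff y).2 h1
      exact hy σ hσ p hp k hkσ hpk
    -- The relation d Φ_k - ∑ n_j Φ_j = 0, extended by zero to all indices; by genericity `y` does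
    -- not respect it.
    obtain ⟨e, hek, heσ, he0⟩ : ∃ e : Fin N → ℤ, e k = d ∧ (∀ i ∈ σ, e i = -n i) ∧
        ∀ i ∉ insert k σ, e i = 0 := by
      refine ⟨fun i => if i = k then d else if i ∈ σ then -n i else 0, if_pos rfl,
        fun i hi => ?_, fun i hi => ?_⟩
      · dsimp only
        rw [if_neg (ne_of_mem_of_not_mem hi hkσ), if_pos hi]
      · rw [Finset.mem_insert, not_or] at hi
        dsimp only
        rw [if_neg hi.1, if_neg hi.2]
    refine sub_eq_zero.1 (eq_zero_of_recurrence
      (D := fun μ => subSum Φ y S μ - subExplicit Γ Φ c y R S μ) (y := y) hc.isOpen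
      (fun a ha r hr => hc.smul_mem ha hr) (hcσ.trans (cone_mono hσS)) hΦ ?_
      (e := e) ?_ ?_ hlam hmem)
    · intro j hj μ hμ hμc
      have h1 := subSum_sub hacute y hj μ
      have h2 := subExplicit_sub (Γ := Γ) (R := R) hy (fun σ hσ => (hR σ hσ).1)
        (fun σ hσ => (hR σ hσ).finite (mem_chamberBases.1 hσ).1 hΦ) hj μ
      have h3 := ih _ (Finset.erase_ssubset hj) hμ hμc
      linear_combination h1 - h2 + h3
    · rw [sum_eq_add_sum_of_insert_subset hkσ hkS hσS fun i hi => by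
        rw [he0 i hi, Int.cast_zero, zero_smul], hek, hrel,
        ← Finset.sum_add_distrib]
      exact Finset.sum_eq_zero fun i hi => by
        rw [heσ i hi]
        push_cast
        module
    · rw [sum_eq_add_sum_of_insert_subset hkσ hkS hσS fun i hi => by
        rw [he0 i hi, Int.cast_zero, mul_zero], hek]
      convert hne using 2
      rw [sub_eq_add_neg, ← Finset.sum_neg_distrib, mul_comm]
      congr 1
      refine Finset.sum_congr rfl fun i hi => ?_
      rw [heσ i hi]
      push_cast
      ring
  · have hno : ∀ a ∈ c, a ∉ cone Φ S := fun a ha haS => hS ⟨a, ha, haS⟩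
    rw [subSum, subPoints_eq_empty hno hmem, finsum_mem_empty, subExplicit, Finset.sum_eq_zero]
    intro σ hσ
    obtain ⟨hσB, hσS⟩ := Finset.mem_filter.1 hσ
    obtain ⟨a, ha⟩ := hc.nonempty
    exact absurd (cone_mono hσS ((mem_chamberBases.1 hσB).2 ha)) (hno a ha)

end Main

end PartitionPolytope

theorem mainTheorem5 {V : Type*} [NormedAddCommGroup V] [NormedSpace ℝ V] [FiniteDimensional ℝ V]
    (Γ : Submodule ℤ V) [DiscreteTopology Γ] [IsZLattice ℝ Γ]
    {N : ℕ} (Φ : Fin N → StrongDual ℝ V)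
    (hΦ : ∀ k, Φ k ∈ PartitionPolytope.dualLattice Γ)
    (hspan : Submodule.span ℝ (Set.range Φ) = ⊤)
    (hacute : ∀ x : Fin N → ℝ, (∀ k, 0 ≤ x k) → ∑ k, x k • Φ k = 0 → x = 0)
    (c : Set (StrongDual ℝ V)) (hc : PartitionPolytope.IsChamber Φ c) :
    (IsOpen {y | PartitionPolytope.IsGeneric Φ c y} ∧
      Dense {y | PartitionPolytope.IsGeneric Φ c y}) ∧
    (c ⊆ PartitionPolytope.cone Φ Finset.univ → closure c ⊆ c - PartitionPolytope.box Φ) ∧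
    ∀ y : Fin N → ℂ, PartitionPolytope.IsGeneric Φ c y →
      ∀ R : Finset (Fin N) → Set (PartitionPolytope.Complexified V),
        (∀ σ ∈ PartitionPolytope.chamberBases Φ c,
          PartitionPolytope.IsReducedSet Γ Φ y σ (R σ)) →
        (∀ σ ∈ PartitionPolytope.chamberBases Φ c, (R σ).Finite) ∧
        ∀ lam ∈ (c - PartitionPolytope.box Φ) ∩
            (PartitionPolytope.dualLattice Γ : Set (StrongDual ℝ V)),
          (PartitionPolytope.latticePoints Φ lam).Finite ∧
          PartitionPolytope.expSum Φ y lam =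
            PartitionPolytope.explicitSum Γ Φ c y R lam
:= by
  refine ⟨⟨PartitionPolytope.isOpen_isGeneric hΦ c, PartitionPolytope.dense_isGeneric hΦ c⟩,
    fun hcone => hc.closure_subset hcone, fun y hy R hR =>
      ⟨fun σ hσ => (hR σ hσ).finite (PartitionPolytope.mem_chamberBases.1 hσ).1 hΦ,
        fun lam hlam => ⟨PartitionPolytope.finite_latticePoints hacute lam, ?_⟩⟩⟩
  rw [← PartitionPolytope.subSum_univ, ← PartitionPolytope.subExplicit_univ]
  refine PartitionPolytope.subSum_eq_subExplicit hacute hΦ hc hy hR Finset.univ hlam.2 ?_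
  rw [← PartitionPolytope.box_eq_subBox]
  exact hlam.1
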